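/- Let $q\in\mathbb R$, $q\neq 0$. All algebras are unital associative $*$-algebras over $\mathbb C$. **Notation.** For $n\ge 1$ let $R_n=q^{-1/n}\big(q\sum_iE_{ii}\otimes E_{ii}+\sum_{i\ne j}E_{ii}\otimes E_{jj}+(q-q^{-1})\sum_{j>i}E_{ij}\otimes E_{ji}\big)$ with entries $R^{ab}{}_{cd}$, $\lambda_n=q^{1-1/n}$, and $\widetilde R=((R^{t_2})^{-1})^{t_2}$, where $t_2$ is transposition in the second tensor factor. (Only $\lambda_n^{-1}R_n$, $\lambda_n\widetilde R_n$ and homogeneous relations in $R_n$ occur below; these do not depend on the choice of the root of $q$.) Repeated indices are summed. The quantum sphere $S_q^{2n-1}$ is the algebra with generators $v^i,x_i$ ($1\le i\le n$), relations $$v^iv^j=\lambda_n^{-1}R^{ij}{}_{kl}\,v^lv^k,\quad x_ix_j=x_lx_k\,\lambda_n^{-1}R^{kl}{}_{ij},\quad x_iv^j=v^kx_l\,\lambda_n\widetilde R^{lj}{}_{ik},\quad v^a g_a{}^b x_b=1,\qquad g_a{}^b=\lambda_n\widetilde R^{bc}{}_{ca},$$ and $x_i^*=v^i$. Let $U_q(1)=\mathbb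 C[z,z^{-1}]$ with $z^*=z^{-1}$; it coacts on $S_q^{2n-1}$ by the $*$-homomorphism $\beta$ with $\beta(x_i)=x_i\otimes z$ (so $\beta(v^i)=v^i\otimes z^*$). The projective quantum space is $$\mathbb{CP}_q^{n-1}=(S_q^{2n-1})^{U_q(1)}=\{u\in S_q^{2n-1}:\beta(u)=u\otimes 1\}.$$ The quantum group $SU_q(2)$ has generators $t^a{}_b$ ($a,b\in\{1,2\}$), relations $R^{ij}{}_{kl}t^k{}_at^l{}_b=t^j{}_lt^i{}_kR^{kl}{}_{ab}$ (with $R=R_2$) and $\nu^{-1}\varepsilon_{ab}t^a{}_ct^b{}_d\varepsilon^{dc}=1$, where $\varepsilon_{12}=\varepsilon^{12}=1$, $\varepsilon_{21}=\varepsilon^{21}=-q$, $\varepsilon_{aa}=\varepsilon^{aa}=0$, $\nu=\varepsilon_{ab}\varepsilon^{ba}$; its coproduct is $\Delta t^a{}_b=t^a{}_k\otimes t^k{}_b$ and its $*$-structure is $(t^a{}_b)^*=S\,t^b{}_a$ with $S$ the antipode. Let $\delta:SU_q(2)\to U_q(1)$ be the homomorphism with $t^1{}_1\mapsto z^*$,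 $t^2{}_2\mapsto z$, $t^1{}_2,t^2{}_1\mapsto 0$, and $$SU_q(2)^{U_q(1)}=\{u\in SU_q(2):(\delta\otimes\mathrm{id})\Delta(u)=1\otimes u\}.$$ Podleś's (standard) quantum 2-sphere $S_q^2$ is the $*$-algebra with generators $A=A^*$, $B$, $B^*$ and relations $$B^*B=A-A^2,\qquad BB^*=q^2A-q^4A^2,\qquad BA=q^2AB,\qquad AB^*=q^2B^*A.$$ **Corollary 3.5.** The projective quantum space $\mathbb{CP}_q^1=(S_q^3)^{U_q(1)}$ is isomorphic, as a $*$-algebra, to Podleś's quantum sphere $S_q^2$, and also to $SU_q(2)^{U_q(1)}$. -/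

import Mathlib

open scoped TensorProduct LaurentPolynomial
open MulOpposite

noncomputable section

set_option linter.unusedSectionVars false

namespace QProj

/-! ## Complex *-algebras given by generators and relations -/

/-- The opposite ring of a complex algebra, with complex conjugated scalar multiplication.
A conjugate-linear anti-multiplicative map `A → B` is an algebra map `A →ₐ[ℂ] ConjOp B`. -/
def ConjOp (A : Type) : Type := Aᵐᵒᵖ

instance (A : Type) [Ring A] : Ring (ConjOp A) := inferInstanceAs (Ring Aᵐᵒᵖ)

instance (A : Type) [Ring A] [Algebra ℂ A] : Algebra ℂ (ConjOp A) :=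
  RingHom.toAlgebra' ((algebraMap ℂ Aᵐᵒᵖ).comp (starRingEnd ℂ) : ℂ →+* Aᵐᵒᵖ)
    (fun c x => Algebra.commutes (A := Aᵐᵒᵖ) (starRingEnd ℂ c) x)

/-- The bijection `A → ConjOp A`. -/
def toConj {A : Type} (a : A) : ConjOp A := op a

/-- The bijection `ConjOp A → A`. -/
def ofConj {A : Type} (a : ConjOp A) : A := unop (α := A) a

section Presentation

variable {A : Type} [Ring A] [Algebra ℂ A]

@[simp] lemma ofConj_toConj (a : A) : ofConj (toConj a) = a := rfl
@[simp] lemma ofConj_one : ofConj (1 : ConjOp A) = 1 := rfl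
@[simp] lemma ofConj_zero : ofConj (0 : ConjOp A) = 0 := rfl
@[simp] lemma ofConj_add (a b : ConjOp A) : ofConj (a + b) = ofConj a + ofConj b := rfl
@[simp] lemma ofConj_sub (a b : ConjOp A) : ofConj (a - b) = ofConj a - ofConj b := rfl
@[simp] lemma ofConj_neg (a : ConjOp A) : ofConj (-a) = -ofConj a := rfl
@[simp] lemma ofConj_mul (a b : ConjOp A) : ofConj (a * b) = ofConj b * ofConj a := rfl

@[simp] lemma ofConj_algebraMap (c : ℂ) :
    ofConj (algebraMap ℂ (ConjOp A) c) = algebraMap ℂ A (star c) := rfl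

@[simp] lemma ofConj_smul (c : ℂ) (a : ConjOp A) : ofConj (c • a) = star c • ofConj a := by
  rw [Algebra.smul_def, ofConj_mul, ofConj_algebraMap, Algebra.smul_def, Algebra.commutes]

@[simp] lemma ofConj_sum {ι : Type} (s : Finset ι) (f : ι → ConjOp A) :
    ofConj (∑ i ∈ s, f i) = ∑ i ∈ s, ofConj (f i) :=
  map_sum (⟨⟨ofConj, rfl⟩, fun _ _ => rfl⟩ : ConjOp A →+ A) f s

lemma ofConj_inj {a b : ConjOp A} (h : ofConj a = ofConj b) : a = b := unop_injective h

variable {X : Type} (r : FreeAlgebra ℂ X → FreeAlgebra ℂ X → Prop)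

/-- The class of a generator in the algebra with generators `X` and relations `r`. -/
def gen (x : X) : RingQuot r := RingQuot.mkAlgHom ℂ r (FreeAlgebra.ι ℂ x)

/-- The conjugate-linear anti-homomorphism on the free algebra with prescribed values
on the generators. -/
def freeStar (s : X → RingQuot r) : FreeAlgebra ℂ X →ₐ[ℂ] ConjOp (RingQuot r) :=
  FreeAlgebra.lift ℂ (fun x => toConj (s x))

@[simp] lemma freeStar_ι (s : X → RingQuot r) (x : X) :
    freeStar r s (FreeAlgebra.ι ℂ x) = toConj (s x) := by
  simp [freeStar]

/-- The conjugate-linear anti-endomorphism of the quotient induced by `freeStar`. -/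
def quotStar (s : X → RingQuot r) (h : ∀ ⦃a b⦄, r a b → freeStar r s a = freeStar r s b) :
    RingQuot r →ₐ[ℂ] ConjOp (RingQuot r) :=
  RingQuot.liftAlgHom ℂ ⟨freeStar r s, h⟩

@[simp] lemma quotStar_gen (s : X → RingQuot r)
    (h : ∀ ⦃a b⦄, r a b → freeStar r s a = freeStar r s b) (x : X) :
    quotStar r s h (gen r x) = toConj (s x) := by
  simp [quotStar, gen, RingQuot.liftAlgHom_mkAlgHom_apply]

variable {r} in
lemma pres_induction {P : RingQuot r → Prop} (hs : ∀ c : ℂ, P (algebraMap ℂ _ c))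
    (hg : ∀ x, P (gen r x)) (ha : ∀ a b, P a → P b → P (a + b))
    (hm : ∀ a b, P a → P b → P (a * b)) (a : RingQuot r) : P a := by
  obtain ⟨a, rfl⟩ := RingQuot.mkAlgHom_surjective ℂ r a
  induction a using FreeAlgebra.induction with
  | grade0 c => simpa using hs c
  | grade1 x => exact hg x
  | mul a b h1 h2 => simpa using hm _ _ h1 h2
  | add a b h1 h2 => simpa using ha _ _ h1 h2

/-- The *-structure on the algebra with generators `X` and relations `r` that takes
the values `s` on the generators. -/
abbrev presStarRing (s : X → RingQuot r)
    (h : ∀ ⦃a b⦄, r a b → freeStar r s a = freeStar r s b)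
    (hs : ∀ x, ofConj (quotStar r s h (s x)) = gen r x) : StarRing (RingQuot r) where
  star a := ofConj (quotStar r s h a)
  star_involutive a := by
    induction a using pres_induction with
    | hs c => simp
    | hg x => simp [hs]
    | ha a b h1 h2 => simp_all
    | hm a b h1 h2 => simp_all
  star_mul a b := by simp
  star_add a b := by simp

/-- A homomorphism to a *-algebra that respects the star of the generators respects the star. -/
lemma map_star_of_gen {B : Type} [Semiring B] [Algebra ℂ B] [StarRing B] [StarModule ℂ B]
    [StarRing (RingQuot r)] [StarModule ℂ (RingQuot r)] (f : RingQuot r →ₐ[ℂ] B)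
    (h : ∀ x, f (star (gen r x)) = star (f (gen r x))) (a : RingQuot r) :
    f (star a) = star (f a) := by
  induction a using pres_induction with
  | hs c => simp [← algebraMap_star_comm]
  | hg x => exact h x
  | ha a b h1 h2 => simp [h1, h2]
  | hm a b h1 h2 => simp [h1, h2]

end Presentation

/-! ## The R-matrix -/

/-- The standard R-matrix without its normalisation,
`q ∑ᵢ Eᵢᵢ ⊗ Eᵢᵢ + ∑_{i ≠ j} Eᵢᵢ ⊗ Eⱼⱼ + (q - q⁻¹) ∑_{j > i} Eᵢⱼ ⊗ Eⱼᵢ`; the entry `R^{ab}_{cd}`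
is `Rmat q n (a, b) (c, d)`. The normalised matrix is `R_n = q^(-1/n) Rmat`. With
`λ_n = q^(1 - 1/n)` only the products `λ_n⁻¹ R_n = q⁻¹ Rmat` and `λ_n R̃_n = q Rtil` occur. -/
def Rmat (q : ℝ) (n : ℕ) : Matrix (Fin n × Fin n) (Fin n × Fin n) ℝ :=
  fun ab cd =>
    (if ab.1 = ab.2 ∧ ab = cd then q else 0) + (if ab.1 ≠ ab.2 ∧ ab = cd then 1 else 0)
      + (if ab.1 < ab.2 ∧ ab.1 = cd.2 ∧ ab.2 = cd.1 then q - q⁻¹ else 0)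

/-- Transposition in the second tensor component. -/
def ptrans {n : ℕ} (M : Matrix (Fin n × Fin n) (Fin n × Fin n) ℝ) :
    Matrix (Fin n × Fin n) (Fin n × Fin n) ℝ :=
  fun ab cd => M (ab.1, cd.2) (cd.1, ab.2)

/-- `R̃ = ((R^{t₂})⁻¹)^{t₂}`, for the R-matrix without its normalisation. -/
def Rtil (q : ℝ) (n : ℕ) : Matrix (Fin n × Fin n) (Fin n × Fin n) ℝ :=
  ptrans (ptrans (Rmat q n))⁻¹

/-- The quantum metric `g_a^b = λ_n ∑_c R̃^{bc}_{ca}`. -/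
def metric (q : ℝ) (n : ℕ) (a b : Fin n) : ℝ := q * ∑ c, Rtil q n (b, c) (c, a)

lemma Rmat_symm (q : ℝ) (n : ℕ) (a b c d : Fin n) :
    Rmat q n (a, b) (c, d) = Rmat q n (d, c) (b, a) := by
  unfold Rmat
  congr 1
  · congr 1
    · refine if_congr ?_ rfl rfl
      simp only [Prod.mk.injEq]; grind
    · refine if_congr ?_ rfl rfl
      simp only [Prod.mk.injEq]; grind
  · refine if_congr ?_ rfl rfl
    grind

lemma Rtil_symm (q : ℝ) (n : ℕ) (a b c d : Fin n) :
    Rtil q n (a, b) (c, d) = Rtil q n (d, c) (b, a) := by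
  have h : (ptrans (Rmat q n)).submatrix (Equiv.prodComm _ _) (Equiv.prodComm _ _)
      = ptrans (Rmat q n) := by
    ext ⟨a, b⟩ ⟨c, d⟩
    simp [ptrans, Rmat_symm q n b c d a]
  have h2 := Matrix.inv_submatrix_equiv (ptrans (Rmat q n))
    (Equiv.prodComm (Fin n) (Fin n)) (Equiv.prodComm (Fin n) (Fin n))
  rw [h] at h2
  have h3 := congrFun (congrFun h2 (a, d)) (c, b)
  simpa [Rtil, ptrans] using h3

lemma metric_symm (q : ℝ) (n : ℕ) (a b : Fin n) : metric q n a b = metric q n b a := by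
  unfold metric
  congr 1
  exact Finset.sum_congr rfl fun c _ => Rtil_symm q n b c c a

/-! ## Quantum spheres -/

/-- The generator `v^i` in the free algebra. -/
abbrev fv {n : ℕ} (i : Fin n) : FreeAlgebra ℂ (Fin n ⊕ Fin n) := FreeAlgebra.ι ℂ (Sum.inl i)

/-- The generator `x_i` in the free algebra. -/
abbrev fx {n : ℕ} (i : Fin n) : FreeAlgebra ℂ (Fin n ⊕ Fin n) := FreeAlgebra.ι ℂ (Sum.inr i)

/-- The relations of the quantum sphere `S_q^{2n-1}`: those of the quantum vectors `v^i`,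
of the quantum covectors `x_i`, the cross relations `x_i v^j = Ψ(x_i ⊗ v^j)` of the braided
tensor product `ℂ_q^n` of the two algebras, and `N = 1` for the quantum norm `N`. -/
inductive SphereRel (q : ℝ) (n : ℕ) :
    FreeAlgebra ℂ (Fin n ⊕ Fin n) → FreeAlgebra ℂ (Fin n ⊕ Fin n) → Prop
  | vv (i j : Fin n) : SphereRel q n (fv i * fv j)
      (∑ k, ∑ l, ((q⁻¹ * Rmat q n (i, j) (k, l) : ℝ) : ℂ) • (fv l * fv k))
  | xx (i j : Fin n) : SphereRel q n (fx i * fx j)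
      (∑ k, ∑ l, ((q⁻¹ * Rmat q n (k, l) (i, j) : ℝ) : ℂ) • (fx l * fx k))
  | xv (i j : Fin n) : SphereRel q n (fx i * fv j)
      (∑ k, ∑ l, ((q * Rtil q n (l, j) (i, k) : ℝ) : ℂ) • (fv k * fx l))
  | norm : SphereRel q n (∑ a, ∑ b, ((metric q n a b : ℝ) : ℂ) • (fv a * fx b)) 1

/-- The algebra of the quantum sphere `S_q^{2n-1}`. -/
abbrev Sphere (q : ℝ) (n : ℕ) : Type := RingQuot (SphereRel q n)

/-- The element `v^i` of the quantum sphere. -/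
def sv (q : ℝ) (n : ℕ) (i : Fin n) : Sphere q n := gen (SphereRel q n) (Sum.inl i)

/-- The element `x_i` of the quantum sphere. -/
def sx (q : ℝ) (n : ℕ) (i : Fin n) : Sphere q n := gen (SphereRel q n) (Sum.inr i)

lemma sv_mul_sv (q : ℝ) (n : ℕ) (i j : Fin n) : sv q n i * sv q n j =
    ∑ k, ∑ l, ((q⁻¹ * Rmat q n (i, j) (k, l) : ℝ) : ℂ) • (sv q n l * sv q n k) := by
  have h := RingQuot.mkAlgHom_rel ℂ (SphereRel.vv (q := q) i j)
  simp only [map_sum, map_smul, map_mul] at h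
  exact h

lemma sx_mul_sx (q : ℝ) (n : ℕ) (i j : Fin n) : sx q n i * sx q n j =
    ∑ k, ∑ l, ((q⁻¹ * Rmat q n (k, l) (i, j) : ℝ) : ℂ) • (sx q n l * sx q n k) := by
  have h := RingQuot.mkAlgHom_rel ℂ (SphereRel.xx (q := q) i j)
  simp only [map_sum, map_smul, map_mul] at h
  exact h

lemma sx_mul_sv (q : ℝ) (n : ℕ) (i j : Fin n) : sx q n i * sv q n j =
    ∑ k, ∑ l, ((q * Rtil q n (l, j) (i, k) : ℝ) : ℂ) • (sv q n k * sx q n l) := by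
  have h := RingQuot.mkAlgHom_rel ℂ (SphereRel.xv (q := q) i j)
  simp only [map_sum, map_smul, map_mul] at h
  exact h

lemma sphere_norm (q : ℝ) (n : ℕ) :
    ∑ a, ∑ b, ((metric q n a b : ℝ) : ℂ) • (sv q n a * sx q n b) = 1 := by
  have h := RingQuot.mkAlgHom_rel ℂ (SphereRel.norm (q := q) (n := n))
  simp only [map_sum, map_smul, map_mul, map_one] at h
  exact h

/-- The star on generators: `(v^i)* = x_i` and `(x_i)* = v^i`. -/
def sphereStarGen (q : ℝ) (n : ℕ) : Fin n ⊕ Fin n → Sphere q n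
  | Sum.inl i => sx q n i
  | Sum.inr i => sv q n i

lemma sphereStar_rel (q : ℝ) (n : ℕ) ⦃a b : FreeAlgebra ℂ (Fin n ⊕ Fin n)⦄
    (h : SphereRel q n a b) : freeStar (SphereRel q n) (sphereStarGen q n) a
      = freeStar (SphereRel q n) (sphereStarGen q n) b := by
  apply ofConj_inj
  cases h with
  | vv i j =>
    simp only [map_sum, map_smul, map_mul, freeStar_ι, sphereStarGen, ofConj_mul, ofConj_sum,
      ofConj_smul, ofConj_toConj, RCLike.star_def, Complex.conj_ofReal]
    rw [sx_mul_sx, Finset.sum_comm]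
    refine Finset.sum_congr rfl fun k _ => Finset.sum_congr rfl fun l _ => ?_
    rw [Rmat_symm]
  | xx i j =>
    simp only [map_sum, map_smul, map_mul, freeStar_ι, sphereStarGen, ofConj_mul, ofConj_sum,
      ofConj_smul, ofConj_toConj, RCLike.star_def, Complex.conj_ofReal]
    rw [sv_mul_sv, Finset.sum_comm]
    refine Finset.sum_congr rfl fun k _ => Finset.sum_congr rfl fun l _ => ?_
    rw [Rmat_symm]
  | xv i j =>
    simp only [map_sum, map_smul, map_mul, freeStar_ι, sphereStarGen, ofConj_mul, ofConj_sum,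
      ofConj_smul, ofConj_toConj, RCLike.star_def, Complex.conj_ofReal]
    rw [sx_mul_sv, Finset.sum_comm]
    refine Finset.sum_congr rfl fun k _ => Finset.sum_congr rfl fun l _ => ?_
    rw [Rtil_symm]
  | norm =>
    simp only [map_sum, map_smul, map_mul, map_one, freeStar_ι, sphereStarGen, ofConj_mul,
      ofConj_sum, ofConj_smul, ofConj_toConj, ofConj_one, RCLike.star_def, Complex.conj_ofReal]
    rw [← sphere_norm q n, Finset.sum_comm]
    refine Finset.sum_congr rfl fun k _ => Finset.sum_congr rfl fun l _ => ?_
    rw [metric_symm]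

/-- The *-structure of the quantum sphere, `(x_i)* = v^i`. -/
instance (q : ℝ) (n : ℕ) : StarRing (Sphere q n) :=
  presStarRing (SphereRel q n) (sphereStarGen q n) (sphereStar_rel q n) (by
    rintro (i | i) <;> simp [sphereStarGen, sx, sv])

instance (q : ℝ) (n : ℕ) : StarModule ℂ (Sphere q n) where
  star_smul c a := by
    change ofConj (quotStar _ _ (sphereStar_rel q n) _) =
      star c • ofConj (quotStar _ _ (sphereStar_rel q n) _)
    simp

lemma star_sv (q : ℝ) (n : ℕ) (i : Fin n) : star (sv q n i) = sx q n i := by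
  change ofConj (quotStar _ _ (sphereStar_rel q n) _) = _
  simp [sv, sphereStarGen]

lemma star_sx (q : ℝ) (n : ℕ) (i : Fin n) : star (sx q n i) = sv q n i := by
  rw [← star_sv, star_star]

/-! ## The quantum group `U_q(1)` -/

/-- `U_q(1)`: the algebra of Laurent polynomials in `z`, with `z* = z⁻¹`. -/
def U1 : Type := ℂ[T;T⁻¹]

instance : CommRing U1 := inferInstanceAs (CommRing ℂ[T;T⁻¹])
instance : Algebra ℂ U1 := inferInstanceAs (Algebra ℂ ℂ[T;T⁻¹])

/-- The power `z ^ k` of the generator of `U_q(1)`. -/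
def zpow (k : ℤ) : U1 := LaurentPolynomial.T (R := ℂ) k

lemma zpow_mul (k l : ℤ) : zpow k * zpow l = zpow (k + l) := (LaurentPolynomial.T_add k l).symm

lemma zpow_zero : zpow 0 = 1 := LaurentPolynomial.T_zero

/-- The conjugate-linear ring endomorphism of `U_q(1)` with `z ↦ z⁻¹`. -/
def u1Conj : U1 →+* U1 :=
  (AddMonoidAlgebra.mapRingHom ℤ (starRingEnd ℂ)).comp
    ((LaurentPolynomial.invert (R := ℂ)).toAlgHom.toRingHom)

/-- The coefficient of `z ^ n` in an element of `U_q(1)`. -/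
def u1Coeff (f : U1) (n : ℤ) : ℂ := AddMonoidAlgebra.coeff (R := ℂ) (M := ℤ) f n

lemma u1_ext {f g : U1} (h : ∀ n, u1Coeff f n = u1Coeff g n) : f = g :=
  AddMonoidAlgebra.ext (R := ℂ) (M := ℤ) (Finsupp.ext h)

lemma u1Coeff_conj (f : U1) (n : ℤ) : u1Coeff (u1Conj f) n = star (u1Coeff f (-n)) := by
  have h (f : ℂ[T;T⁻¹]) : (AddMonoidAlgebra.mapRingHom ℤ (starRingEnd ℂ)
      (LaurentPolynomial.invert f)).coeff n = star (f.coeff (-n)) := by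
    rw [AddMonoidAlgebra.coeff_mapRingHom, LaurentPolynomial.invert_apply]
    rfl
  exact h f

lemma u1Coeff_smul (c : ℂ) (f : U1) (n : ℤ) : u1Coeff (c • f) n = c * u1Coeff f n := rfl

lemma u1Conj_zpow (k : ℤ) : u1Conj (zpow k) = zpow (-k) := by
  refine u1_ext fun n => ?_
  rw [u1Coeff_conj]
  have h (k n : ℤ) : u1Coeff (zpow k) n = if k = n then 1 else 0 :=
    LaurentPolynomial.T_apply n k
  rw [h, h]
  split_ifs <;> first | omega | simp

lemma u1Conj_smul (c : ℂ) (f : U1) : u1Conj (c • f) = star c • u1Conj f :=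
  u1_ext fun n => by simp [u1Coeff_conj, u1Coeff_smul]

/-- The *-structure of `U_q(1)`. -/
instance : StarRing U1 where
  star := u1Conj
  star_involutive f := by
    exact u1_ext fun n => by simp [u1Coeff_conj]
  star_mul a b := by rw [map_mul, mul_comm]
  star_add a b := map_add _ _ _

instance : StarModule ℂ U1 where
  star_smul := u1Conj_smul

lemma star_zpow (k : ℤ) : star (zpow k) = zpow (-k) := u1Conj_zpow k

/-! ## Complex projective quantum spaces -/

/-- The degree of the generators for the coaction of `U_q(1)`. -/
def sphereDeg {n : ℕ} : Fin n ⊕ Fin n → ℤ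
  | Sum.inl _ => -1
  | Sum.inr _ => 1

/-- The coaction `x_i ↦ x_i ⊗ z`, `v^i ↦ v^i ⊗ z*` of `U_q(1)` on the quantum sphere,
as a homomorphism of algebras. -/
def sphereCoactAlg (q : ℝ) (n : ℕ) : Sphere q n →ₐ[ℂ] Sphere q n ⊗[ℂ] U1 :=
  RingQuot.liftAlgHom ℂ ⟨FreeAlgebra.lift ℂ
    (fun g => gen (SphereRel q n) g ⊗ₜ[ℂ] zpow (sphereDeg g)), by
      intro a b h
      cases h with
      | vv i j =>
        have := sv_mul_sv q n i j
        unfold sv at this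
        simp [sphereDeg, zpow_mul, this, TensorProduct.sum_tmul, TensorProduct.smul_tmul']
      | xx i j =>
        have := sx_mul_sx q n i j
        unfold sx at this
        simp [sphereDeg, zpow_mul, this, TensorProduct.sum_tmul, TensorProduct.smul_tmul']
      | xv i j =>
        have := sx_mul_sv q n i j
        unfold sx sv at this
        simp [sphereDeg, zpow_mul, this, TensorProduct.sum_tmul, TensorProduct.smul_tmul']
      | norm =>
        have := sphere_norm q n
        unfold sx sv at this
        simp only [map_sum, map_smul, map_mul, map_one, FreeAlgebra.lift_ι_apply, sphereDeg,
          Algebra.TensorProduct.tmul_mul_tmul, zpow_mul, TensorProduct.smul_tmul',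
          ← TensorProduct.sum_tmul, this, Algebra.TensorProduct.one_def]
        rw [← zpow_zero]; rfl⟩

lemma sphereCoactAlg_sv (q : ℝ) (n : ℕ) (i : Fin n) :
    sphereCoactAlg q n (sv q n i) = sv q n i ⊗ₜ[ℂ] zpow (-1) := by
  simp [sphereCoactAlg, sv, gen, RingQuot.liftAlgHom_mkAlgHom_apply, sphereDeg]

lemma sphereCoactAlg_sx (q : ℝ) (n : ℕ) (i : Fin n) :
    sphereCoactAlg q n (sx q n i) = sx q n i ⊗ₜ[ℂ] zpow 1 := by
  simp [sphereCoactAlg, sx, gen, RingQuot.liftAlgHom_mkAlgHom_apply, sphereDeg]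

/-- The coaction of `U_q(1)` on the quantum sphere, as a homomorphism of *-algebras. -/
def sphereCoact (q : ℝ) (n : ℕ) : Sphere q n →⋆ₐ[ℂ] Sphere q n ⊗[ℂ] U1 where
  toAlgHom := sphereCoactAlg q n
  map_star' := by
    refine map_star_of_gen (SphereRel q n) (sphereCoactAlg q n) ?_
    rintro (i | i)
    · change sphereCoactAlg q n (star (sv q n i)) = star (sphereCoactAlg q n (sv q n i))
      simp [star_sv, sphereCoactAlg_sv, sphereCoactAlg_sx, star_zpow]
    · change sphereCoactAlg q n (star (sx q n i)) = star (sphereCoactAlg q n (sx q n i))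
      simp [star_sx, sphereCoactAlg_sv, sphereCoactAlg_sx, star_zpow]

/-- The complex projective quantum space `ℂP_q^{n-1} = (S_q^{2n-1})^{U_q(1)}`: the *-subalgebra
of the elements `u` of the quantum sphere with `β(u) = u ⊗ 1`. -/
def ProjSpace (q : ℝ) (n : ℕ) : StarSubalgebra ℂ (Sphere q n) where
  toSubalgebra := AlgHom.equalizer (sphereCoact q n : Sphere q n →ₐ[ℂ] Sphere q n ⊗[ℂ] U1)
    Algebra.TensorProduct.includeLeft
  star_mem' {u} hu := by
    change sphereCoact q n u = u ⊗ₜ[ℂ] 1 at hu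
    change sphereCoact q n (star u) = star u ⊗ₜ[ℂ] 1
    rw [map_star, hu, TensorProduct.star_tmul, star_one]

lemma mem_projSpace (q : ℝ) (n : ℕ) (u : Sphere q n) :
    u ∈ ProjSpace q n ↔ sphereCoact q n u = u ⊗ₜ[ℂ] 1 := Iff.rfl

/-! ## The quantum group `SU_q(2)` -/

/-- The generator `t^a_b` in the free algebra. -/
abbrev ft (a b : Fin 2) : FreeAlgebra ℂ (Fin 2 × Fin 2) := FreeAlgebra.ι ℂ (a, b)

/-- The symbol `ε_{ab} = ε^{ab}`: `(-q)^{l(σ)}` for the permutation `σ` with `σ(1, 2) = (a, b)`,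
and zero if `a = b`. -/
def eps (q : ℝ) (a b : Fin 2) : ℂ := if a < b then 1 else if b < a then -(q : ℂ) else 0

/-- The quantum determinant `ν⁻¹ ε_{ab} t^a_c t^b_d ε^{dc}`, with `ν = ε_{ab} ε^{ba}`. -/
def qdet (q : ℝ) : FreeAlgebra ℂ (Fin 2 × Fin 2) :=
  (∑ a, ∑ b, eps q a b * eps q b a)⁻¹ •
    ∑ a, ∑ b, ∑ c, ∑ d, (eps q a b * eps q d c) • (ft a c * ft b d)

/-- The relations `R t₁ t₂ = t₂ t₁ R` and `det = 1` of `SU_q(2)`. -/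
inductive SURel (q : ℝ) :
    FreeAlgebra ℂ (Fin 2 × Fin 2) → FreeAlgebra ℂ (Fin 2 × Fin 2) → Prop
  | rtt (i j a b : Fin 2) : SURel q
      (∑ k, ∑ l, ((Rmat q 2 (i, j) (k, l) : ℝ) : ℂ) • (ft k a * ft l b))
      (∑ k, ∑ l, ((Rmat q 2 (k, l) (a, b) : ℝ) : ℂ) • (ft j l * ft i k))
  | det : SURel q (qdet q) 1

/-- The algebra of the quantum group `SU_q(2)`. -/
abbrev SU2 (q : ℝ) : Type := RingQuot (SURel q)

/-- The element `t^a_b` of `SU_q(2)`. -/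
def st (q : ℝ) (a b : Fin 2) : SU2 q := gen (SURel q) (a, b)

lemma st_rtt (q : ℝ) (i j a b : Fin 2) :
    (∑ k, ∑ l, ((Rmat q 2 (i, j) (k, l) : ℝ) : ℂ) • (st q k a * st q l b)) =
      ∑ k, ∑ l, ((Rmat q 2 (k, l) (a, b) : ℝ) : ℂ) • (st q j l * st q i k) := by
  have h := RingQuot.mkAlgHom_rel ℂ (SURel.rtt (q := q) i j a b)
  simp only [map_sum, map_smul, map_mul] at h
  exact h

section Relations

variable (q : ℝ) [NeZero q]

lemma q_ne : (q : ℂ) ≠ 0 := by exact_mod_cast NeZero.ne q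

lemma st_ba : st q 0 1 * st q 0 0 = (q : ℂ) • (st q 0 0 * st q 0 1) := by
  have h := st_rtt q 0 0 0 1
  simp [Rmat, Fin.sum_univ_two] at h
  exact h.symm

lemma st_dc : st q 1 1 * st q 1 0 = (q : ℂ) • (st q 1 0 * st q 1 1) := by
  have h := st_rtt q 1 1 0 1
  simp [Rmat, Fin.sum_univ_two] at h
  exact h.symm

lemma st_ca : st q 1 0 * st q 0 0 = (q : ℂ) • (st q 0 0 * st q 1 0) := by
  have h := st_rtt q 1 0 0 0
  simp [Rmat, Fin.sum_univ_two] at h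
  exact h

lemma st_db : st q 1 1 * st q 0 1 = (q : ℂ) • (st q 0 1 * st q 1 1) := by
  have h := st_rtt q 1 0 1 1
  simp [Rmat, Fin.sum_univ_two] at h
  exact h

lemma st_cb : st q 1 0 * st q 0 1 = st q 0 1 * st q 1 0 := by
  have h := st_rtt q 1 0 0 1
  simp [Rmat, Fin.sum_univ_two] at h
  exact h

lemma st_comm_da : st q 1 1 * st q 0 0 =
    st q 0 0 * st q 1 1 + ((q : ℂ) - (q : ℂ)⁻¹) • (st q 0 1 * st q 1 0) := by
  have h := st_rtt q 0 1 0 1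
  simp [Rmat, Fin.sum_univ_two] at h
  rw [← h, st_cb]

lemma st_ad : st q 0 0 * st q 1 1 = 1 + (q : ℂ)⁻¹ • (st q 0 1 * st q 1 0) := by
  have h := RingQuot.mkAlgHom_rel ℂ (SURel.det (q := q))
  simp only [qdet, map_sum, map_smul, map_mul, map_one] at h
  change (_ : ℂ) • (∑ a, ∑ b, ∑ c, ∑ d, (_ : ℂ) • (st q a c * st q b d)) = 1 at h
  have hq := q_ne q
  simp [eps, Fin.sum_univ_two, st_cb, st_comm_da, -Complex.coe_smul] at h
  rw [← h]
  match_scalars <;> (field_simp; try ring)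

lemma st_da : st q 1 1 * st q 0 0 = 1 + (q : ℂ) • (st q 0 1 * st q 1 0) := by
  rw [st_comm_da, st_ad]
  module

/-- Homomorphisms on `SU_q(2)` are given by four elements with the normal ordered relations. -/
lemma suRel_of {B : Type} [Semiring B] [Algebra ℂ B] (f : FreeAlgebra ℂ (Fin 2 × Fin 2) →ₐ[ℂ] B)
    (hba : f (ft 0 1) * f (ft 0 0) = (q : ℂ) • (f (ft 0 0) * f (ft 0 1)))
    (hdc : f (ft 1 1) * f (ft 1 0) = (q : ℂ) • (f (ft 1 0) * f (ft 1 1)))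
    (hca : f (ft 1 0) * f (ft 0 0) = (q : ℂ) • (f (ft 0 0) * f (ft 1 0)))
    (hdb : f (ft 1 1) * f (ft 0 1) = (q : ℂ) • (f (ft 0 1) * f (ft 1 1)))
    (hcb : f (ft 1 0) * f (ft 0 1) = f (ft 0 1) * f (ft 1 0))
    (had : f (ft 0 0) * f (ft 1 1) = 1 + (q : ℂ)⁻¹ • (f (ft 0 1) * f (ft 1 0)))
    (hda : f (ft 1 1) * f (ft 0 0) = 1 + (q : ℂ) • (f (ft 0 1) * f (ft 1 0)))
    ⦃u v : FreeAlgebra ℂ (Fin 2 × Fin 2)⦄ (h : SURel q u v) : f u = f v := by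
  let _ : Ring B := Algebra.semiringToRing ℂ
  have hq := q_ne q
  have hq' : q ≠ 0 := NeZero.ne q
  cases h with
  | rtt i j a b =>
    simp only [map_sum, map_smul, map_mul]
    fin_cases i <;> fin_cases j <;> fin_cases a <;> fin_cases b <;>
      simp [Rmat, Fin.sum_univ_two, hba, hdc, hca, hdb, hcb, had, hda, -Complex.coe_smul] <;>
      try (match_scalars <;> field_simp <;> ring)
  | det =>
    simp only [qdet, map_sum, map_smul, map_mul, map_one]
    simp [eps, Fin.sum_univ_two, hcb, had, hda, -Complex.coe_smul]
    match_scalars <;> (field_simp; try ring)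

/-- The antipode on generators, `S t = [[d, -q b], [-q⁻¹ c, a]]`. -/
def antipodeGen : Fin 2 → Fin 2 → SU2 q :=
  ![![st q 1 1, -(q : ℂ) • st q 0 1], ![-(q : ℂ)⁻¹ • st q 1 0, st q 0 0]]

/-- The star on generators, `(t^a_b)* = S t^b_a`. -/
def suStarGen (g : Fin 2 × Fin 2) : SU2 q := antipodeGen q g.2 g.1

lemma suStar_rel ⦃a b : FreeAlgebra ℂ (Fin 2 × Fin 2)⦄ (h : SURel q a b) :
    freeStar (SURel q) (suStarGen q) a = freeStar (SURel q) (suStarGen q) b := by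
  have hq := q_ne q
  refine suRel_of q _ ?_ ?_ ?_ ?_ ?_ ?_ ?_ h <;> apply ofConj_inj <;>
    simp [suStarGen, antipodeGen, st_ba, st_dc, st_ca, st_db, st_cb, st_ad, st_da, smul_smul, hq]

/-- The *-structure of `SU_q(2)`, `(t^a_b)* = S t^b_a`. -/
instance : StarRing (SU2 q) :=
  presStarRing (SURel q) (suStarGen q) (suStar_rel q) (by
    have hq := q_ne q
    have h (a b : Fin 2) : quotStar (SURel q) (suStarGen q) (suStar_rel q) (st q a b)
      = toConj (suStarGen q (a, b)) := quotStar_gen _ _ _ _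
    rintro ⟨a, b⟩
    change _ = st q a b
    fin_cases a <;> fin_cases b <;>
      simp [suStarGen, antipodeGen, h, smul_smul, hq])

instance : StarModule ℂ (SU2 q) where
  star_smul c a := by
    change ofConj (quotStar _ _ (suStar_rel q) _) = star c • ofConj (quotStar _ _ (suStar_rel q) _)
    simp

lemma star_st (a b : Fin 2) : star (st q a b) = antipodeGen q b a := by
  change ofConj (quotStar _ _ (suStar_rel q) _) = _
  simp [st, suStarGen]

/-- The coproduct `Δ t^a_b = ∑_k t^a_k ⊗ t^k_b` of `SU_q(2)`. -/
def suComul : SU2 q →ₐ[ℂ] SU2 q ⊗[ℂ] SU2 q :=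
  RingQuot.liftAlgHom ℂ ⟨FreeAlgebra.lift ℂ
    (fun g => ∑ k, st q g.1 k ⊗ₜ[ℂ] st q k g.2), by
      have hq := q_ne q
      refine suRel_of q _ ?_ ?_ ?_ ?_ ?_ ?_ ?_ <;>
      simp [Fin.sum_univ_two, mul_add, add_mul, st_ba, st_dc, st_ca, st_db, st_cb, st_ad, st_da,
        TensorProduct.tmul_add, TensorProduct.add_tmul, TensorProduct.tmul_smul,
        ← TensorProduct.smul_tmul', smul_smul, hq, Algebra.TensorProduct.one_def] <;>
      match_scalars <;> field_simp⟩

lemma suComul_st (a b : Fin 2) : suComul q (st q a b) = ∑ k, st q a k ⊗ₜ[ℂ] st q k b := by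
  simp [suComul, st, gen, RingQuot.liftAlgHom_mkAlgHom_apply]

/-- The homomorphism `δ : SU_q(2) → U_q(1)` with `t^1_1 ↦ z*`, `t^2_2 ↦ z`, and
`t^1_2, t^2_1 ↦ 0`. -/
def suDelta : SU2 q →ₐ[ℂ] U1 :=
  RingQuot.liftAlgHom ℂ ⟨FreeAlgebra.lift ℂ
    (fun g => if g.1 = g.2 then (if g.1 = 0 then zpow (-1) else zpow 1) else 0), by
      refine suRel_of q _ ?_ ?_ ?_ ?_ ?_ ?_ ?_ <;> simp [zpow_mul, zpow_zero]⟩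

lemma suDelta_st (a b : Fin 2) : suDelta q (st q a b) =
    if a = b then (if a = 0 then zpow (-1) else zpow 1) else 0 := by
  simp [suDelta, st, gen, RingQuot.liftAlgHom_mkAlgHom_apply]

/-- The left coaction `(δ ⊗ id) ∘ Δ` of `U_q(1)` on `SU_q(2)`, as a homomorphism of algebras. -/
def suCoactAlg : SU2 q →ₐ[ℂ] U1 ⊗[ℂ] SU2 q :=
  (Algebra.TensorProduct.map (suDelta q) (AlgHom.id ℂ (SU2 q))).comp (suComul q)

lemma suCoactAlg_st (a b : Fin 2) : suCoactAlg q (st q a b) =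
    (if a = 0 then zpow (-1) else zpow 1) ⊗ₜ[ℂ] st q a b := by
  fin_cases a <;> simp [suCoactAlg, suComul_st, suDelta_st, Fin.sum_univ_two]

/-- The left coaction of `U_q(1)` on `SU_q(2)`, as a homomorphism of *-algebras. -/
def suCoact : SU2 q →⋆ₐ[ℂ] U1 ⊗[ℂ] SU2 q where
  toAlgHom := suCoactAlg q
  map_star' := by
    refine map_star_of_gen (SURel q) (suCoactAlg q) ?_
    rintro ⟨a, b⟩
    change suCoactAlg q (star (st q a b)) = star (suCoactAlg q (st q a b))
    rw [suCoactAlg_st, TensorProduct.star_tmul, star_st]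
    fin_cases a <;> fin_cases b <;>
      simp [antipodeGen, suCoactAlg_st, star_zpow, TensorProduct.tmul_smul]

/-- The algebra `SU_q(2)^{U_q(1)}`: the *-subalgebra of the elements `u` of `SU_q(2)` with
`β(u) = 1 ⊗ u` for the left coaction `β = (δ ⊗ id) ∘ Δ`. -/
def SUInvariants : StarSubalgebra ℂ (SU2 q) where
  toSubalgebra := AlgHom.equalizer (suCoact q : SU2 q →ₐ[ℂ] U1 ⊗[ℂ] SU2 q)
    Algebra.TensorProduct.includeRight
  star_mem' {u} hu := by
    change suCoact q u = 1 ⊗ₜ[ℂ] u at hu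
    change suCoact q (star u) = 1 ⊗ₜ[ℂ] star u
    rw [map_star, hu, TensorProduct.star_tmul, star_one]

lemma mem_suInvariants (u : SU2 q) :
    u ∈ SUInvariants q ↔ suCoact q u = 1 ⊗ₜ[ℂ] u := Iff.rfl

end Relations

/-! ## The quantum sphere of Podleś -/

/-- The generators `A`, `B` and `B*`. -/
inductive PodGen : Type
  | A
  | B
  | Bs

/-- The relations `B*B = A - A²`, `BB* = q²A - q⁴A²`, `BA = q²AB` and `AB* = q²B*A` of the
standard sphere of Podleś, the member of parameter `c = 0` of his family. -/
inductive PodRel (q : ℝ) : FreeAlgebra ℂ PodGen → FreeAlgebra ℂ PodGen → Prop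
  | BsB : PodRel q (FreeAlgebra.ι ℂ .Bs * FreeAlgebra.ι ℂ .B)
      (FreeAlgebra.ι ℂ .A - FreeAlgebra.ι ℂ .A ^ 2)
  | BBs : PodRel q (FreeAlgebra.ι ℂ .B * FreeAlgebra.ι ℂ .Bs)
      ((q : ℂ) ^ 2 • FreeAlgebra.ι ℂ .A - (q : ℂ) ^ 4 • FreeAlgebra.ι ℂ .A ^ 2)
  | BA : PodRel q (FreeAlgebra.ι ℂ .B * FreeAlgebra.ι ℂ .A)
      ((q : ℂ) ^ 2 • (FreeAlgebra.ι ℂ .A * FreeAlgebra.ι ℂ .B))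
  | ABs : PodRel q (FreeAlgebra.ι ℂ .A * FreeAlgebra.ι ℂ .Bs)
      ((q : ℂ) ^ 2 • (FreeAlgebra.ι ℂ .Bs * FreeAlgebra.ι ℂ .A))

/-- The algebra of the quantum sphere `S_q^2` of Podleś. -/
abbrev Podles (q : ℝ) : Type := RingQuot (PodRel q)

/-- The star on generators: `A* = A` and `B ↔ B*`. -/
def podStarGen (q : ℝ) : PodGen → Podles q
  | .A => gen (PodRel q) .A
  | .B => gen (PodRel q) .Bs
  | .Bs => gen (PodRel q) .B

lemma podStar_rel (q : ℝ) ⦃a b : FreeAlgebra ℂ PodGen⦄ (h : PodRel q a b) :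
    freeStar (PodRel q) (podStarGen q) a = freeStar (PodRel q) (podStarGen q) b := by
  apply ofConj_inj
  have h1 := RingQuot.mkAlgHom_rel ℂ h
  cases h with
  | BA =>
    have h2 := RingQuot.mkAlgHom_rel ℂ (PodRel.ABs (q := q))
    simpa [podStarGen, gen, pow_two] using h2
  | ABs =>
    have h2 := RingQuot.mkAlgHom_rel ℂ (PodRel.BA (q := q))
    simpa [podStarGen, gen, pow_two] using h2
  | BsB => simpa [podStarGen, gen, pow_two] using h1
  | BBs => simpa [podStarGen, gen, pow_two] using h1

/-- The *-structure of the quantum sphere of Podleś. -/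
instance (q : ℝ) : StarRing (Podles q) :=
  presStarRing (PodRel q) (podStarGen q) (podStar_rel q) (by
    rintro (_ | _ | _) <;> simp [podStarGen])

instance (q : ℝ) : StarModule ℂ (Podles q) where
  star_smul c a := by
    change ofConj (quotStar _ _ (podStar_rel q) _) =
      star c • ofConj (quotStar _ _ (podStar_rel q) _)
    simp

lemma star_podGen (q : ℝ) (g : PodGen) : star (gen (PodRel q) g) = podStarGen q g := by
  change ofConj (quotStar _ _ (podStar_rel q) _) = _
  simp

end QProj

namespace QProj

/-! ## The relations of the quantum sphere `S_q^3` -/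

section SphereRelations

variable (q : ℝ) [NeZero q]

/-! For two indices the relations of `S_q^3` can be written out. Besides q-commutation they say that
`v⁰` and `x₀` commute, that `v¹x₁ = 1 - q⁻²v⁰x₀` and that `x₁v¹ = 1 - v⁰x₀`. These are the relations
of `SU_q(2)` for the matrix with first row `v¹, q⁻¹v⁰` and second row `-x₀, x₁`. The first row has
degree -1 and the second degree 1 for `U_q(1)`, so this *-isomorphism (`sphereEquivSU`) intertwines
the two coactions and identifies the invariants.

For Podleś's sphere, `A = q⁻²v⁰x₀`, `B = v⁰x₁`, `B* = v¹x₀` satisfy the required relations and have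
degree 0. Two facts remain.

Surjectivity (`mem_range_podToSphere`): let `P` be the image and `V`, `X` the spans of the `vⁱ` and
of the `xᵢ`. Then `VX` and `XV` lie in `P`, while `VP ⊆ PV` and `XP ⊆ PX`. Hence the sum of all
`PVᵏ` and `PXᵏ` is stable under right multiplication by the generators and is the whole of `S_q^3`.
Its degree 0 part is `P`.

Injectivity (`podToSphere_injective`): the elements `p(A)Bⁿ`, with `B⁻ⁿ` read as `(B*)ⁿ`, span
`S_q^2`. In a representation of `S_q^3` on sequences of polynomials, `B` and `B*` shift the index in
opposite directions and `A` multiplies entry `n` by `q⁻²⁻²ⁿX`. Different `n` are separated by their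
position, and polynomials in `A` by the free variable `X`. This works for every nonzero `q`,
including `q = ±1`. -/

lemma Rtil_two (a b c d : Fin 2) : Rtil q 2 (a, b) (c, d) =
    (if a = b ∧ (a, b) = (c, d) then q⁻¹ else 0)
      + (if a ≠ b ∧ (a, b) = (c, d) then 1 else 0)
      + (if a < b ∧ a = d ∧ b = c then -(q - q⁻¹) * q⁻¹ ^ 2 else 0) := by
  have hq : q ≠ 0 := NeZero.ne q
  -- The only block of `R^{t₂}` that is not diagonal is `[[q, q - q⁻¹], [0, q]]`, on `e₀ ⊗ e₀` and
  -- `e₁ ⊗ e₁`; its inverse has the corner `-(q - q⁻¹)q⁻²`.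
  set N : Matrix (Fin 2 × Fin 2) (Fin 2 × Fin 2) ℝ := fun ab cd =>
    (if ab.1 = cd.2 ∧ (ab.1, cd.2) = (cd.1, ab.2) then q⁻¹ else 0)
      + (if ab.1 ≠ cd.2 ∧ (ab.1, cd.2) = (cd.1, ab.2) then 1 else 0)
      + (if ab.1 < cd.2 ∧ ab.1 = ab.2 ∧ cd.2 = cd.1 then -(q - q⁻¹) * q⁻¹ ^ 2 else 0) with hN
  have h : (ptrans (Rmat q 2))⁻¹ = N := by
    refine Matrix.inv_eq_right_inv ?_
    ext ⟨a, b⟩ ⟨c, d⟩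
    rw [Matrix.mul_apply, Fintype.sum_prod_type]
    fin_cases a <;> fin_cases b <;> fin_cases c <;> fin_cases d <;>
      simp [Fin.sum_univ_two, ptrans, Rmat, hN, hq]
    field_simp
    ring
  rw [Rtil, h]
  simp only [ptrans, hN]

lemma sv_one_zero : sv q 2 1 * sv q 2 0 = (q : ℂ)⁻¹ • (sv q 2 0 * sv q 2 1) := by
  have h := sv_mul_sv q 2 1 0
  simpa [Rmat, Fin.sum_univ_two, -Complex.coe_smul] using h

lemma sx_zero_one : sx q 2 0 * sx q 2 1 = (q : ℂ)⁻¹ • (sx q 2 1 * sx q 2 0) := by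
  have h := sx_mul_sx q 2 0 1
  simpa [Rmat, Fin.sum_univ_two, -Complex.coe_smul] using h

lemma sx_sv_zero_zero : sx q 2 0 * sv q 2 0 = sv q 2 0 * sx q 2 0 := by
  have hq := q_ne q
  have h := sx_mul_sv q 2 0 0
  simpa [Rtil_two, Fin.sum_univ_two, -Complex.coe_smul, hq] using h

lemma sx_sv_zero_one : sx q 2 0 * sv q 2 1 = (q : ℂ) • (sv q 2 1 * sx q 2 0) := by
  have h := sx_mul_sv q 2 0 1
  simpa [Rtil_two, Fin.sum_univ_two, -Complex.coe_smul] using h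

lemma sx_sv_one_zero : sx q 2 1 * sv q 2 0 = (q : ℂ) • (sv q 2 0 * sx q 2 1) := by
  have h := sx_mul_sv q 2 1 0
  simpa [Rtil_two, Fin.sum_univ_two, -Complex.coe_smul] using h

/-- The quantum metric is diagonal with entries `q⁻²` and `1`, so the norm relation can be solved
for `v¹x₁`. -/
lemma sv_sx_one_one : sv q 2 1 * sx q 2 1 = 1 - (q : ℂ)⁻¹ ^ 2 • (sv q 2 0 * sx q 2 0) := by
  have hq := q_ne q
  have h := sphere_norm q 2
  simp [metric, Rtil_two, Fin.sum_univ_two, -Complex.coe_smul] at h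
  rw [← h]
  match_scalars <;> field_simp
  ring

/-- The cross relation gives `x₁v¹ = v¹x₁ - (1 - q⁻²)v⁰x₀`; the norm relation then eliminates
`v¹x₁`. -/
lemma sx_sv_one_one : sx q 2 1 * sv q 2 1 = 1 - sv q 2 0 * sx q 2 0 := by
  have hq := q_ne q
  have h := sx_mul_sv q 2 1 1
  simp [Rtil_two, Fin.sum_univ_two, -Complex.coe_smul, hq, sv_sx_one_one] at h
  rw [h]
  match_scalars <;> field_simp
  ring

/-- Homomorphisms on `S_q^3` are given by four elements with the normal ordered relations. -/
lemma sphereRel_of {B : Type} [Ring B] [Algebra ℂ B]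
    (f : FreeAlgebra ℂ (Fin 2 ⊕ Fin 2) →ₐ[ℂ] B)
    (hvv : f (fv 1) * f (fv 0) = (q : ℂ)⁻¹ • (f (fv 0) * f (fv 1)))
    (hxx : f (fx 0) * f (fx 1) = (q : ℂ)⁻¹ • (f (fx 1) * f (fx 0)))
    (h00 : f (fx 0) * f (fv 0) = f (fv 0) * f (fx 0))
    (h01 : f (fx 0) * f (fv 1) = (q : ℂ) • (f (fv 1) * f (fx 0)))
    (h10 : f (fx 1) * f (fv 0) = (q : ℂ) • (f (fv 0) * f (fx 1)))
    (hn : f (fv 1) * f (fx 1) = 1 - (q : ℂ)⁻¹ ^ 2 • (f (fv 0) * f (fx 0)))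
    (h11 : f (fx 1) * f (fv 1) = 1 - f (fv 0) * f (fx 0))
    ⦃u v : FreeAlgebra ℂ (Fin 2 ⊕ Fin 2)⦄ (h : SphereRel q 2 u v) : f u = f v := by
  have hq := q_ne q
  cases h with
  | vv i j =>
    simp only [map_sum, map_smul, map_mul]
    fin_cases i <;> fin_cases j <;>
      simp [Rmat, Fin.sum_univ_two, hvv, -Complex.coe_smul, hq]
    match_scalars
    field_simp
    ring
  | xx i j =>
    simp only [map_sum, map_smul, map_mul]
    fin_cases i <;> fin_cases j <;>
      simp [Rmat, Fin.sum_univ_two, hxx, -Complex.coe_smul, hq]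
    match_scalars
    field_simp
    ring
  | xv i j =>
    simp only [map_sum, map_smul, map_mul]
    fin_cases i <;> fin_cases j <;>
      simp [Rtil_two, Fin.sum_univ_two, h00, h01, h10, hn, h11, -Complex.coe_smul, hq]
    match_scalars <;> field_simp
    ring
  | norm =>
    simp only [map_sum, map_smul, map_mul, map_one]
    simp [metric, Rtil_two, Fin.sum_univ_two, hn, -Complex.coe_smul]
    match_scalars <;> field_simp
    ring

end SphereRelations

/-! ## The quantum sphere `S_q^3` and the quantum group `SU_q(2)` -/

section SphereSU

lemma pres_hom_ext {X : Type} {r : FreeAlgebra ℂ X → FreeAlgebra ℂ X → Prop} {B : Type}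
    [Semiring B] [Algebra ℂ B] {f g : RingQuot r →ₐ[ℂ] B}
    (h : ∀ x, f (gen r x) = g (gen r x)) : f = g :=
  RingQuot.ringQuot_ext' ℂ f g (FreeAlgebra.hom_ext (funext h))

/-- The homomorphism from a presented algebra with prescribed values on the generators. -/
def presLift {X : Type} {r : FreeAlgebra ℂ X → FreeAlgebra ℂ X → Prop} {B : Type}
    [Semiring B] [Algebra ℂ B] (s : X → B)
    (h : ∀ ⦃a b⦄, r a b → FreeAlgebra.lift ℂ s a = FreeAlgebra.lift ℂ s b) :
    RingQuot r →ₐ[ℂ] B :=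
  RingQuot.liftAlgHom ℂ ⟨FreeAlgebra.lift ℂ s, h⟩

@[simp] lemma presLift_gen {X : Type} {r : FreeAlgebra ℂ X → FreeAlgebra ℂ X → Prop} {B : Type}
    [Semiring B] [Algebra ℂ B] (s : X → B)
    (h : ∀ ⦃a b⦄, r a b → FreeAlgebra.lift ℂ s a = FreeAlgebra.lift ℂ s b) (x : X) :
    presLift s h (gen r x) = s x := by
  simp [presLift, gen, RingQuot.liftAlgHom_mkAlgHom_apply]

variable (q : ℝ) [NeZero q]

/-- The homomorphism `S_q^3 → SU_q(2)` with `v = (q t^1_2, t^1_1)` and `x = (-t^2_1, t^2_2)`. -/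
def sphereToSU : Sphere q 2 →ₐ[ℂ] SU2 q :=
  presLift (Sum.elim ![(q : ℂ) • st q 0 1, st q 0 0] ![(-1 : ℂ) • st q 1 0, st q 1 1]) (by
    have hq := q_ne q
    refine sphereRel_of q _ ?_ ?_ ?_ ?_ ?_ ?_ ?_ <;>
      simp [st_ba, st_dc, st_ca, st_db, st_cb, st_ad, st_da, smul_smul, hq, -Complex.coe_smul, -neg_smul, -one_smul]
    all_goals match_scalars <;> field_simp)

lemma sphereToSU_sv (i : Fin 2) :
    sphereToSU q (sv q 2 i) = ![(q : ℂ) • st q 0 1, st q 0 0] i :=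
  presLift_gen _ _ _

lemma sphereToSU_sx (i : Fin 2) :
    sphereToSU q (sx q 2 i) = ![(-1 : ℂ) • st q 1 0, st q 1 1] i :=
  presLift_gen _ _ _

/-- The inverse of `sphereToSU`. -/
def suToSphere : SU2 q →ₐ[ℂ] Sphere q 2 :=
  presLift (fun g => ![![sv q 2 1, (q : ℂ)⁻¹ • sv q 2 0], ![(-1 : ℂ) • sx q 2 0, sx q 2 1]] g.1 g.2) (by
    have hq := q_ne q
    refine suRel_of q _ ?_ ?_ ?_ ?_ ?_ ?_ ?_ <;>
      simp [sv_one_zero, sx_zero_one, sx_sv_zero_zero, sx_sv_zero_one, sx_sv_one_zero,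
        sv_sx_one_one, sx_sv_one_one, smul_smul, hq, -Complex.coe_smul, -neg_smul, -one_smul]
    all_goals match_scalars <;> field_simp)

lemma suToSphere_st (a b : Fin 2) : suToSphere q (st q a b) =
    ![![sv q 2 1, (q : ℂ)⁻¹ • sv q 2 0], ![(-1 : ℂ) • sx q 2 0, sx q 2 1]] a b :=
  presLift_gen (r := SURel q) _ _ (a, b)

lemma suToSphere_comp : (suToSphere q).comp (sphereToSU q) = AlgHom.id ℂ _ := by
  have hq := q_ne q
  refine pres_hom_ext ?_
  rintro (i | i)
  · change suToSphere q (sphereToSU q (sv q 2 i)) = sv q 2 i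
    fin_cases i <;> simp [sphereToSU_sv, suToSphere_st, hq, smul_smul, -Complex.coe_smul]
  · change suToSphere q (sphereToSU q (sx q 2 i)) = sx q 2 i
    fin_cases i <;> simp [sphereToSU_sx, suToSphere_st, smul_smul, -neg_smul]

lemma sphereToSU_comp : (sphereToSU q).comp (suToSphere q) = AlgHom.id ℂ _ := by
  have hq := q_ne q
  refine pres_hom_ext ?_
  rintro ⟨a, b⟩
  change sphereToSU q (suToSphere q (st q a b)) = st q a b
  fin_cases a <;> fin_cases b <;>
    simp [sphereToSU_sv, sphereToSU_sx, suToSphere_st, hq, smul_smul, -Complex.coe_smul]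

/-- In `SU_q(2)` the star exchanges `q t^1_2` with `-t^2_1` and `t^1_1` with `t^2_2`, which accounts
for the factor `q` in `sphereToSU`. -/
lemma sphereToSU_star (u : Sphere q 2) : sphereToSU q (star u) = star (sphereToSU q u) := by
  have hq := q_ne q
  refine map_star_of_gen (SphereRel q 2) (sphereToSU q) ?_ u
  rintro (i | i)
  · change sphereToSU q (star (sv q 2 i)) = star (sphereToSU q (sv q 2 i))
    fin_cases i <;> simp [star_sv, sphereToSU_sv, sphereToSU_sx, star_st, antipodeGen, hq,
      smul_smul, -Complex.coe_smul, -neg_smul, -one_smul]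
  · change sphereToSU q (star (sx q 2 i)) = star (sphereToSU q (sx q 2 i))
    fin_cases i <;> simp [star_sx, sphereToSU_sv, sphereToSU_sx, star_st, antipodeGen,
      smul_smul, -Complex.coe_smul, -neg_smul, -one_smul]

/-- The isomorphism of *-algebras `S_q^3 ≃ SU_q(2)`. -/
def sphereEquivSU : Sphere q 2 ≃⋆ₐ[ℂ] SU2 q :=
  StarAlgEquiv.ofBijective
    ({ sphereToSU q with map_star' := sphereToSU_star q } : Sphere q 2 →⋆ₐ[ℂ] SU2 q)
    (AlgEquiv.ofAlgHom _ _ (sphereToSU_comp q) (suToSphere_comp q)).bijective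

lemma sphereEquivSU_apply (u : Sphere q 2) : sphereEquivSU q u = sphereToSU q u := rfl

/-- The isomorphism `S_q^3 ≃ SU_q(2)` intertwines the coactions of `U_q(1)`. -/
lemma suCoact_sphereToSU (u : Sphere q 2) : suCoactAlg q (sphereToSU q u) =
    Algebra.TensorProduct.comm ℂ _ _
      (Algebra.TensorProduct.congr (sphereEquivSU q).toAlgEquiv AlgEquiv.refl
        (sphereCoactAlg q 2 u)) := by
  suffices h : (suCoactAlg q).comp (sphereToSU q) =
      ((Algebra.TensorProduct.comm ℂ (SU2 q) U1).toAlgHom.comp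
        (Algebra.TensorProduct.congr (sphereEquivSU q).toAlgEquiv AlgEquiv.refl).toAlgHom).comp
        (sphereCoactAlg q 2) from DFunLike.congr_fun h u
  refine pres_hom_ext ?_
  rintro (i | i)
  · change suCoactAlg q (sphereToSU q (sv q 2 i)) = Algebra.TensorProduct.comm ℂ _ _
      (Algebra.TensorProduct.congr (sphereEquivSU q).toAlgEquiv AlgEquiv.refl
        (sphereCoactAlg q 2 (sv q 2 i)))
    fin_cases i <;> simp [sphereCoactAlg_sv, sphereEquivSU_apply, sphereToSU_sv, suCoactAlg_st,
      -Complex.coe_smul]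
  · change suCoactAlg q (sphereToSU q (sx q 2 i)) = Algebra.TensorProduct.comm ℂ _ _
      (Algebra.TensorProduct.congr (sphereEquivSU q).toAlgEquiv AlgEquiv.refl
        (sphereCoactAlg q 2 (sx q 2 i)))
    fin_cases i <;> simp [sphereCoactAlg_sx, sphereEquivSU_apply, sphereToSU_sx, suCoactAlg_st,
      -neg_smul, -one_smul]

/-- The isomorphism of tensor products that carries one coaction to the other also carries `u ⊗ 1`
to `1 ⊗ sphereToSU q u`; being injective, it transports invariance both ways. -/
lemma sphereEquivSU_mem_iff (u : Sphere q 2) :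
    sphereEquivSU q u ∈ SUInvariants q ↔ u ∈ ProjSpace q 2 := by
  rw [mem_suInvariants, mem_projSpace]
  change suCoactAlg q (sphereToSU q u) = 1 ⊗ₜ[ℂ] sphereToSU q u ↔ sphereCoactAlg q 2 u = u ⊗ₜ 1
  have h : (1 : U1) ⊗ₜ[ℂ] sphereToSU q u = Algebra.TensorProduct.comm ℂ _ _
      (Algebra.TensorProduct.congr (sphereEquivSU q).toAlgEquiv AlgEquiv.refl
        (u ⊗ₜ[ℂ] (1 : U1))) := by
    simp [sphereEquivSU_apply]
  rw [suCoact_sphereToSU, h, EmbeddingLike.apply_eq_iff_eq, EmbeddingLike.apply_eq_iff_eq]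

/-- An isomorphism of *-algebras restricts to corresponding *-subalgebras. -/
lemma nonempty_starAlgEquiv_of_mem_iff {A B : Type} [Ring A] [Algebra ℂ A] [StarRing A]
    [StarModule ℂ A] [Ring B] [Algebra ℂ B] [StarRing B] [StarModule ℂ B] (e : A ≃⋆ₐ[ℂ] B)
    (S : StarSubalgebra ℂ A) (T : StarSubalgebra ℂ B) (h : ∀ a, e a ∈ T ↔ a ∈ S) :
    Nonempty (S ≃⋆ₐ[ℂ] T) := by
  refine ⟨StarAlgEquiv.ofBijective
    (StarAlgHom.codRestrict ((e : A →⋆ₐ[ℂ] B).comp S.subtype) T fun a => (h a).2 a.2) ⟨?_, ?_⟩⟩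
  · intro a b hab
    exact Subtype.ext (e.injective (congrArg Subtype.val hab))
  · rintro ⟨b, hb⟩
    obtain ⟨a, rfl⟩ := e.surjective b
    exact ⟨⟨a, (h a).1 hb⟩, rfl⟩

theorem projSpace_equiv_suInvariants : Nonempty (ProjSpace q 2 ≃⋆ₐ[ℂ] SUInvariants q) :=
  nonempty_starAlgEquiv_of_mem_iff (sphereEquivSU q) _ _ (sphereEquivSU_mem_iff q)

end SphereSU

end QProj

namespace QProj

/-! ## Decompositions of algebras generated in degrees `1` and `-1` -/

section Decomposition

variable {A : Type} [Ring A] [Algebra ℂ A] (P : Subalgebra ℂ A) {V X : Submodule ℂ A}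

/-- The sum of the products `P Vᵏ` for `k ∈ ℕ`. -/
def powerSum (V : Submodule ℂ A) : Submodule ℂ A := ⨆ k : ℕ, P.toSubmodule * V ^ k

lemma mul_pow_le_powerSum (V : Submodule ℂ A) (k : ℕ) : P.toSubmodule * V ^ k ≤ powerSum P V :=
  le_iSup (fun k : ℕ => P.toSubmodule * V ^ k) k

variable {P}

lemma pow_mul_le (h : V * P.toSubmodule ≤ P.toSubmodule * V) (k : ℕ) :
    V ^ k * P.toSubmodule ≤ P.toSubmodule * V ^ k := by
  induction k with
  | zero => simp
  | succ k ih =>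
    calc V ^ (k + 1) * P.toSubmodule = V ^ k * (V * P.toSubmodule) := by rw [pow_succ, mul_assoc]
      _ ≤ V ^ k * (P.toSubmodule * V) := mul_le_mul_right h _
      _ = (V ^ k * P.toSubmodule) * V := by rw [mul_assoc]
      _ ≤ (P.toSubmodule * V ^ k) * V := mul_le_mul_left ih _
      _ = P.toSubmodule * V ^ (k + 1) := by rw [pow_succ, mul_assoc]

lemma powerSum_mul_self_le : powerSum P V * V ≤ powerSum P V := by
  rw [powerSum, Submodule.iSup_mul]
  refine iSup_le fun k => ?_
  rw [mul_assoc, ← pow_succ]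
  exact mul_pow_le_powerSum P V (k + 1)

/-- A right factor `X` cancels the last `V` of `PVᵏ⁺¹` into `P`, and this `P` moves left through
`Vᵏ`. For `k = 0` there is nothing to cancel and the product falls into `PX`. -/
lemma powerSum_mul_le (hV : V * P.toSubmodule ≤ P.toSubmodule * V)
    (hVX : V * X ≤ P.toSubmodule) : powerSum P V * X ≤ powerSum P X ⊔ powerSum P V := by
  nth_rewrite 1 [powerSum]
  rw [Submodule.iSup_mul]
  refine iSup_le fun k => ?_
  cases k with
  | zero =>
    refine le_trans ?_ le_sup_left
    simpa using mul_pow_le_powerSum P X 1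
  | succ k =>
    refine le_trans ?_ le_sup_right
    calc P.toSubmodule * V ^ (k + 1) * X
        = P.toSubmodule * V ^ k * (V * X) := by rw [pow_succ]; simp only [mul_assoc]
      _ ≤ P.toSubmodule * V ^ k * P.toSubmodule := mul_le_mul_right hVX _
      _ = P.toSubmodule * (V ^ k * P.toSubmodule) := by rw [mul_assoc]
      _ ≤ P.toSubmodule * (P.toSubmodule * V ^ k) := mul_le_mul_right (pow_mul_le hV k) _
      _ = P.toSubmodule * V ^ k := by
        rw [← mul_assoc, P.isIdempotentElem_toSubmodule]
      _ ≤ powerSum P V := mul_pow_le_powerSum P V k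

lemma sup_powerSum_mul_le (hV : V * P.toSubmodule ≤ P.toSubmodule * V)
    (hVX : V * X ≤ P.toSubmodule) :
    (powerSum P X ⊔ powerSum P V) * X ≤ powerSum P X ⊔ powerSum P V := by
  rw [Submodule.sup_mul]
  exact sup_le (powerSum_mul_self_le.trans le_sup_left) (powerSum_mul_le hV hVX)

lemma one_mem_powerSum : (1 : A) ∈ powerSum P V :=
  mul_pow_le_powerSum P V 0 (by simp)

/-- A submodule of a presented algebra that contains `1` and is stable under right multiplication
with the generators is everything. -/
lemma mem_of_mul_gen_mem {Y : Type} {r : FreeAlgebra ℂ Y → FreeAlgebra ℂ Y → Prop}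
    (M : Submodule ℂ (RingQuot r)) (h1 : 1 ∈ M) (hM : ∀ m ∈ M, ∀ y, m * gen r y ∈ M)
    (a : RingQuot r) : a ∈ M := by
  -- The statement is for all `m` at once, since a product `ab` acts by `a` first and then by `b` on
  -- the new element of `M`.
  have h (a : RingQuot r) : ∀ m ∈ M, m * a ∈ M := by
    induction a using pres_induction with
    | hs c =>
      intro m hm
      rw [← Algebra.commutes, ← Algebra.smul_def]
      exact M.smul_mem c hm
    | hg y => exact fun m hm => hM m hm y
    | ha a b ha hb =>
      intro m hm
      rw [mul_add]
      exact M.add_mem (ha m hm) (hb m hm)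
    | hm a b ha hb =>
      intro m hm
      rw [← mul_assoc]
      exact hb _ (ha m hm)
  simpa using h a 1 h1

/-- Commutation past the image `P` need only be tested on generators: if it holds for `f a` and `f
b`, then `V f(a) f(b) ⊆ P V f(b) ⊆ PPV = PV`. -/
lemma mul_range_le {Y : Type} {r : FreeAlgebra ℂ Y → FreeAlgebra ℂ Y → Prop}
    (f : RingQuot r →ₐ[ℂ] A)
    (h : ∀ y, ∀ w ∈ V, w * f (gen r y) ∈ f.range.toSubmodule * V) :
    V * f.range.toSubmodule ≤ f.range.toSubmodule * V := by
  have key (a : RingQuot r) : ∀ w ∈ V, w * f a ∈ f.range.toSubmodule * V := by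
    induction a using pres_induction with
    | hs c =>
      intro w hw
      rw [AlgHom.commutes, ← Algebra.commutes]
      exact Submodule.mul_mem_mul (f.range.algebraMap_mem c) hw
    | hg y => exact h y
    | ha a b ha hb =>
      intro w hw
      rw [map_add, mul_add]
      exact add_mem (ha w hw) (hb w hw)
    | hm a b ha hb =>
      intro w hw
      rw [map_mul, ← mul_assoc]
      refine Submodule.mul_induction_on (ha w hw) (fun m hm n hn => ?_) fun x y hx hy => ?_
      · rw [mul_assoc, ← f.range.isIdempotentElem_toSubmodule, mul_assoc]
        exact Submodule.mul_mem_mul hm (hb n hn)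
      · rw [add_mul]
        exact add_mem hx hy
  rw [Submodule.mul_le]
  rintro w hw _ ⟨a, rfl⟩
  exact key a w hw

end Decomposition

/-! ## The homomorphism from the sphere of Podleś to `S_q^3` -/

section PodlesToSphere

lemma pod_BsB (q : ℝ) : gen (PodRel q) .Bs * gen (PodRel q) .B =
    gen (PodRel q) .A - gen (PodRel q) .A ^ 2 := by
  simpa [gen] using RingQuot.mkAlgHom_rel ℂ (PodRel.BsB (q := q))

lemma pod_BBs (q : ℝ) : gen (PodRel q) .B * gen (PodRel q) .Bs =
    (q : ℂ) ^ 2 • gen (PodRel q) .A - (q : ℂ) ^ 4 • gen (PodRel q) .A ^ 2 := by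
  simpa [gen] using RingQuot.mkAlgHom_rel ℂ (PodRel.BBs (q := q))

lemma pod_BA (q : ℝ) : gen (PodRel q) .B * gen (PodRel q) .A =
    (q : ℂ) ^ 2 • (gen (PodRel q) .A * gen (PodRel q) .B) := by
  simpa [gen] using RingQuot.mkAlgHom_rel ℂ (PodRel.BA (q := q))

lemma pod_ABs (q : ℝ) : gen (PodRel q) .A * gen (PodRel q) .Bs =
    (q : ℂ) ^ 2 • (gen (PodRel q) .Bs * gen (PodRel q) .A) := by
  simpa [gen] using RingQuot.mkAlgHom_rel ℂ (PodRel.ABs (q := q))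

variable (q : ℝ) [NeZero q]

/-- The images of the generators `A = q⁻² v⁰ x₀`, `B = v⁰ x₁`, `B* = v¹ x₀`, for indices `0, 1`. -/
def podToSphereGen : PodGen → Sphere q 2
  | .A => (q : ℂ)⁻¹ ^ 2 • (sv q 2 0 * sx q 2 0)
  | .B => sv q 2 0 * sx q 2 1
  | .Bs => sv q 2 1 * sx q 2 0

/-- The homomorphism `S_q^2 → S_q^3` with `A ↦ q⁻² v⁰ x₀`, `B ↦ v⁰ x₁`, `B* ↦ v¹ x₀`,
for indices `0, 1`. -/
def podToSphere : Podles q →ₐ[ℂ] Sphere q 2 :=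
  presLift (podToSphereGen q) (by
    have hq := q_ne q
    have hmid (a b c d : Sphere q 2) : a * b * (c * d) = a * (b * c) * d := by
      simp only [mul_assoc]
    intro u v h
    cases h with
    | BsB =>
      simp only [map_mul, map_sub, map_pow, FreeAlgebra.lift_ι_apply, podToSphereGen]
      -- Reordering places `v¹x₁` in the middle, where the norm relation turns it into an expression
      -- in `v⁰x₀`; the two exchanges `v¹v⁰` and `x₀x₁` cost `q⁻¹` each.
      have h1 : sv q 2 1 * sx q 2 0 * (sv q 2 0 * sx q 2 1) =
          (q : ℂ)⁻¹ ^ 2 • (sv q 2 0 * (sv q 2 1 * sx q 2 1) * sx q 2 0) := by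
        rw [hmid, sx_sv_zero_zero, ← mul_assoc, sv_one_zero, smul_mul_assoc, smul_mul_assoc,
          mul_assoc _ _ (sx q 2 1), sx_zero_one, mul_smul_comm, smul_smul, ← pow_two]
        simp only [mul_assoc]
      have h2 : sv q 2 0 * (sv q 2 0 * sx q 2 0) * sx q 2 0 =
          sv q 2 0 * sx q 2 0 * (sv q 2 0 * sx q 2 0) := by
        rw [hmid, sx_sv_zero_zero]
      rw [h1, sv_sx_one_one, mul_sub, sub_mul, mul_one, mul_smul_comm, smul_mul_assoc, h2, smul_pow,
        pow_two (_ * _), smul_sub, smul_smul, ← pow_mul, ← pow_add]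
    | BBs =>
      simp only [map_mul, map_sub, map_pow, map_smul, FreeAlgebra.lift_ι_apply, podToSphereGen]
      have h2 : sv q 2 0 * (sv q 2 0 * sx q 2 0) * sx q 2 0 =
          sv q 2 0 * sx q 2 0 * (sv q 2 0 * sx q 2 0) := by
        rw [hmid, sx_sv_zero_zero]
      rw [hmid, sx_sv_one_one, mul_sub, sub_mul, mul_one, h2, smul_pow, pow_two (sv q 2 0 * sx q 2 0)]
      match_scalars <;> field_simp
    | BA =>
      simp only [map_mul, map_smul, FreeAlgebra.lift_ι_apply, podToSphereGen]
      rw [mul_smul_comm, smul_mul_assoc, hmid, hmid, sx_sv_one_zero, sx_sv_zero_zero]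
      simp only [smul_mul_assoc, mul_smul_comm, mul_assoc, sx_zero_one, smul_smul]
      match_scalars
      field_simp
    | ABs =>
      simp only [map_mul, map_smul, FreeAlgebra.lift_ι_apply, podToSphereGen]
      rw [mul_smul_comm, smul_mul_assoc, hmid, hmid, sx_sv_zero_one, sx_sv_zero_zero,
        ← mul_assoc (sv q 2 1), sv_one_zero]
      simp only [smul_mul_assoc, mul_smul_comm, mul_assoc, smul_smul]
      match_scalars
      field_simp)

lemma podToSphere_gen (g : PodGen) : podToSphere q (gen (PodRel q) g) = podToSphereGen q g :=
  presLift_gen _ _ _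

lemma podToSphere_star (u : Podles q) : podToSphere q (star u) = star (podToSphere q u) := by
  refine map_star_of_gen (PodRel q) (podToSphere q) ?_ u
  rintro (_ | _ | _) <;>
    simp [star_podGen, podStarGen, podToSphere_gen, podToSphereGen, star_sv, star_sx,
      -Complex.coe_smul]

/-! ### The image -/

/-- The span of the generators `vⁱ`. -/
def vSpan : Submodule ℂ (Sphere q 2) := Submodule.span ℂ (Set.range (sv q 2))

/-- The span of the generators `xᵢ`. -/
def xSpan : Submodule ℂ (Sphere q 2) := Submodule.span ℂ (Set.range (sx q 2))

lemma sv_mem_vSpan (i : Fin 2) : sv q 2 i ∈ vSpan q := Submodule.subset_span ⟨i, rfl⟩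

lemma sx_mem_xSpan (i : Fin 2) : sx q 2 i ∈ xSpan q := Submodule.subset_span ⟨i, rfl⟩

lemma podToSphereGen_mem_range (g : PodGen) :
    podToSphereGen q g ∈ (podToSphere q).range :=
  ⟨_, podToSphere_gen q g⟩

lemma sv_sx_zero_zero_mem_range : sv q 2 0 * sx q 2 0 ∈ (podToSphere q).range := by
  have hq := q_ne q
  have h := (podToSphere q).range.smul_mem (podToSphereGen_mem_range q .A) ((q : ℂ) ^ 2)
  simpa [podToSphereGen, smul_smul, hq, -Complex.coe_smul] using h

/-- Three of the products are multiples of images of generators; the fourth, `v¹x₁`, comes from the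
norm relation. -/
lemma sv_mul_sx_mem_range (i j : Fin 2) : sv q 2 i * sx q 2 j ∈ (podToSphere q).range := by
  have h := sv_sx_zero_zero_mem_range q
  fin_cases i <;> fin_cases j
  · exact h
  · exact podToSphereGen_mem_range q .B
  · exact podToSphereGen_mem_range q .Bs
  · change sv q 2 1 * sx q 2 1 ∈ _
    rw [sv_sx_one_one]
    exact sub_mem (one_mem _) (Subalgebra.smul_mem _ h _)

lemma sx_mul_sv_mem_range (i j : Fin 2) : sx q 2 i * sv q 2 j ∈ (podToSphere q).range := by
  rw [sx_mul_sv]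
  exact sum_mem fun k _ => sum_mem fun l _ => Subalgebra.smul_mem _ (sv_mul_sx_mem_range q k l) _

lemma vSpan_mul_xSpan_le : vSpan q * xSpan q ≤ (podToSphere q).range.toSubmodule := by
  rw [vSpan, xSpan, Submodule.span_mul_span, Submodule.span_le]
  rintro _ ⟨_, ⟨i, rfl⟩, _, ⟨j, rfl⟩, rfl⟩
  exact sv_mul_sx_mem_range q i j

lemma xSpan_mul_vSpan_le : xSpan q * vSpan q ≤ (podToSphere q).range.toSubmodule := by
  rw [vSpan, xSpan, Submodule.span_mul_span, Submodule.span_le]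
  rintro _ ⟨_, ⟨i, rfl⟩, _, ⟨j, rfl⟩, rfl⟩
  exact sx_mul_sv_mem_range q i j

lemma podToSphereGen_mem_vSpan_mul_xSpan (g : PodGen) :
    podToSphereGen q g ∈ vSpan q * xSpan q := by
  have h (i j : Fin 2) : sv q 2 i * sx q 2 j ∈ vSpan q * xSpan q :=
    Submodule.mul_mem_mul (sv_mem_vSpan q i) (sx_mem_xSpan q j)
  cases g with
  | A => exact Submodule.smul_mem _ _ (h 0 0)
  | B => exact h 0 1
  | Bs => exact h 1 0

/-- The product `v¹x₁` does not occur in the images of the generators, and for the other products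
the cross relation only rescales by `1` or `q`. -/
lemma podToSphereGen_mem_xSpan_mul_vSpan (g : PodGen) :
    podToSphereGen q g ∈ xSpan q * vSpan q := by
  have hq := q_ne q
  have h (i j : Fin 2) : sx q 2 i * sv q 2 j ∈ xSpan q * vSpan q :=
    Submodule.mul_mem_mul (sx_mem_xSpan q i) (sv_mem_vSpan q j)
  cases g with
  | A =>
    rw [podToSphereGen, ← sx_sv_zero_zero]
    exact Submodule.smul_mem _ _ (h 0 0)
  | B =>
    rw [podToSphereGen, ← inv_smul_smul₀ hq (sv q 2 0 * sx q 2 1), ← sx_sv_one_zero]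
    exact Submodule.smul_mem _ _ (h 1 0)
  | Bs =>
    rw [podToSphereGen, ← inv_smul_smul₀ hq (sv q 2 1 * sx q 2 0), ← sx_sv_zero_one]
    exact Submodule.smul_mem _ _ (h 0 1)

lemma vSpan_mul_range_le : vSpan q * (podToSphere q).range.toSubmodule ≤
    (podToSphere q).range.toSubmodule * vSpan q := by
  -- A generator of the image lies in `XV`, and `V(XV) = (VX)V ⊆ PV`.
  refine mul_range_le _ fun g w hw => mul_le_mul_left (vSpan_mul_xSpan_le q) _ ?_
  rw [podToSphere_gen, mul_assoc]
  exact Submodule.mul_mem_mul hw (podToSphereGen_mem_xSpan_mul_vSpan q g)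

lemma xSpan_mul_range_le : xSpan q * (podToSphere q).range.toSubmodule ≤
    (podToSphere q).range.toSubmodule * xSpan q := by
  refine mul_range_le _ fun g w hw => mul_le_mul_left (xSpan_mul_vSpan_le q) _ ?_
  rw [podToSphere_gen, mul_assoc]
  exact Submodule.mul_mem_mul hw (podToSphereGen_mem_vSpan_mul_xSpan q g)

lemma mem_powerSum_sup_powerSum (u : Sphere q 2) :
    u ∈ powerSum (podToSphere q).range (xSpan q) ⊔ powerSum (podToSphere q).range (vSpan q) := by
  refine mem_of_mul_gen_mem _ (le_sup_left (a := powerSum _ _) one_mem_powerSum) ?_ u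
  rintro m hm (i | i)
  -- The hypotheses are symmetric in `V` and `X`, so the case of `vⁱ` is that of `xᵢ` with the roles
  -- exchanged.
  · rw [sup_comm] at hm ⊢
    exact sup_powerSum_mul_le (xSpan_mul_range_le q) (xSpan_mul_vSpan_le q)
      (Submodule.mul_mem_mul hm (sv_mem_vSpan q i))
  · exact sup_powerSum_mul_le (vSpan_mul_range_le q) (vSpan_mul_xSpan_le q)
      (Submodule.mul_mem_mul hm (sx_mem_xSpan q i))

/-! ### The grading defined by the coaction, and its part of degree zero -/

/-- The elements of degree `k` for the coaction of `U_q(1)`. -/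
def degSubmodule (k : ℤ) : Submodule ℂ (Sphere q 2) :=
  LinearMap.eqLocus (sphereCoactAlg q 2).toLinearMap ((TensorProduct.mk ℂ _ _).flip (zpow k))

lemma mem_degSubmodule {k : ℤ} {u : Sphere q 2} :
    u ∈ degSubmodule q k ↔ sphereCoactAlg q 2 u = u ⊗ₜ[ℂ] zpow k := Iff.rfl

lemma mul_mem_degSubmodule {k l : ℤ} {u v : Sphere q 2} (hu : u ∈ degSubmodule q k)
    (hv : v ∈ degSubmodule q l) : u * v ∈ degSubmodule q (k + l) := by
  rw [mem_degSubmodule] at *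
  rw [map_mul, hu, hv, Algebra.TensorProduct.tmul_mul_tmul, zpow_mul]

lemma podToSphere_mem_degSubmodule (a : Podles q) : podToSphere q a ∈ degSubmodule q 0 := by
  have h (i j : Fin 2) : sv q 2 i * sx q 2 j ∈ degSubmodule q 0 := by
    rw [mem_degSubmodule, map_mul, sphereCoactAlg_sv, sphereCoactAlg_sx,
      Algebra.TensorProduct.tmul_mul_tmul, zpow_mul, neg_add_cancel]
  induction a using pres_induction with
  | hs c =>
    rw [mem_degSubmodule, AlgHom.commutes, AlgHom.commutes, zpow_zero,
      Algebra.TensorProduct.algebraMap_apply]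
  | hg g =>
    rw [podToSphere_gen]
    cases g with
    | A => exact Submodule.smul_mem _ _ (h 0 0)
    | B => exact h 0 1
    | Bs => exact h 1 0
  | ha a b ha hb =>
    rw [map_add]
    exact add_mem ha hb
  | hm a b ha hb =>
    rw [map_mul]
    simpa using mul_mem_degSubmodule q ha hb

lemma podToSphere_mem_projSpace (a : Podles q) : podToSphere q a ∈ ProjSpace q 2 := by
  have h := podToSphere_mem_degSubmodule q a
  rwa [mem_degSubmodule, zpow_zero] at h

lemma pow_le_degSubmodule {W : Submodule ℂ (Sphere q 2)} {d : ℤ} (h : W ≤ degSubmodule q d)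
    (k : ℕ) : (podToSphere q).range.toSubmodule * W ^ k ≤ degSubmodule q (k * d) := by
  induction k with
  | zero =>
    rw [pow_zero, mul_one]
    rintro _ ⟨a, rfl⟩
    simpa using podToSphere_mem_degSubmodule q a
  | succ k ih =>
    rw [pow_succ, ← mul_assoc, Submodule.mul_le]
    intro m hm n hn
    have := mul_mem_degSubmodule q (ih hm) (h hn)
    rwa [show ((k + 1 : ℕ) : ℤ) * d = k * d + d by push_cast; ring]

/-- The coefficient of `z ^ 0` as a linear map. -/
def u1CoeffZero : U1 →ₗ[ℂ] ℂ where
  toFun f := u1Coeff f 0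
  map_add' _ _ := rfl
  map_smul' := fun c f => u1Coeff_smul c f 0

lemma u1CoeffZero_zpow (k : ℤ) : u1CoeffZero (zpow k) = if k = 0 then 1 else 0 :=
  LaurentPolynomial.T_apply 0 k

/-- The projection of `S_q^3` onto the elements of degree `0`. -/
def degZeroProj : Sphere q 2 →ₗ[ℂ] Sphere q 2 :=
  (TensorProduct.rid ℂ (Sphere q 2)).toLinearMap ∘ₗ
    (u1CoeffZero.lTensor (Sphere q 2)) ∘ₗ (sphereCoactAlg q 2).toLinearMap

lemma degZeroProj_of_mem {k : ℤ} {u : Sphere q 2} (hu : u ∈ degSubmodule q k) :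
    degZeroProj q u = if k = 0 then u else 0 := by
  rw [mem_degSubmodule] at hu
  simp only [degZeroProj, LinearMap.comp_apply, AlgHom.toLinearMap_apply, hu,
    LinearMap.lTensor_tmul, u1CoeffZero_zpow, LinearEquiv.coe_coe, TensorProduct.rid_tmul]
  split_ifs <;> simp

/-- The summand `PWᵏ` has degree `kd`, so the projection kills it unless `k = 0`, where it is `P`
itself. -/
lemma powerSum_le_comap_degZeroProj {W : Submodule ℂ (Sphere q 2)} {d : ℤ} (hd : d ≠ 0)
    (h : W ≤ degSubmodule q d) : powerSum (podToSphere q).range W ≤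
      (podToSphere q).range.toSubmodule.comap (degZeroProj q) := by
  refine iSup_le fun k u hu => ?_
  rw [Submodule.mem_comap, degZeroProj_of_mem q (pow_le_degSubmodule q h k hu)]
  cases k with
  | zero => simpa using hu
  | succ k =>
    rw [if_neg (mul_ne_zero (by exact_mod_cast Nat.succ_ne_zero k) hd)]
    exact zero_mem _

/-- The projection to degree 0 fixes an invariant `u`, yet it sends every element of the
decomposition into the image. -/
lemma mem_range_podToSphere {u : Sphere q 2} (hu : u ∈ ProjSpace q 2) :
    u ∈ (podToSphere q).range := by
  have hu0 : u ∈ degSubmodule q 0 := by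
    rw [mem_projSpace] at hu
    rw [mem_degSubmodule, zpow_zero]
    exact hu
  have hv : vSpan q ≤ degSubmodule q (-1) := by
    rw [vSpan, Submodule.span_le]
    rintro _ ⟨i, rfl⟩
    exact sphereCoactAlg_sv q 2 i
  have hx : xSpan q ≤ degSubmodule q 1 := by
    rw [xSpan, Submodule.span_le]
    rintro _ ⟨i, rfl⟩
    exact sphereCoactAlg_sx q 2 i
  have h := sup_le (powerSum_le_comap_degZeroProj q one_ne_zero hx)
    (powerSum_le_comap_degZeroProj q (by decide) hv) (mem_powerSum_sup_powerSum q u)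
  rw [Submodule.mem_comap, degZeroProj_of_mem q hu0, if_pos rfl] at h
  exact h

end PodlesToSphere

end QProj

namespace QProj

/-! ## A spanning family of the sphere of Podleś -/

section Spanning

open Polynomial

lemma pow_mul_of_skew {A : Type} [Ring A] [Algebra ℂ A] {a y : A} {c : ℂ}
    (h : y * a = c • (a * y)) (k : ℕ) : y ^ k * a = c ^ k • (a * y ^ k) := by
  induction k with
  | zero => simp
  | succ k ih =>
    rw [pow_succ, mul_assoc, h, mul_smul_comm, ← mul_assoc, ih, smul_mul_assoc, smul_smul,
      ← pow_succ', mul_assoc]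

lemma mul_aeval_of_skew {A : Type} [Ring A] [Algebra ℂ A] {a y : A} {c : ℂ}
    (h : y * a = c • (a * y)) (p : ℂ[X]) :
    y * aeval a p = aeval a (p.comp (C c * X)) * y := by
  induction p using Polynomial.induction_on with
  | C b => simp [Algebra.commutes]
  | add p r hp hr => simp [mul_add, add_mul, hp, hr]
  | monomial k b ih =>
    have h1 (s : ℂ[X]) (hs : y * aeval a s = aeval a (s.comp (C c * X)) * y) :
        y * aeval a (s * X) = aeval a ((s * X).comp (C c * X)) * y := by
      rw [map_mul, aeval_X, ← mul_assoc, hs, mul_assoc, h, mul_comp, X_comp, map_mul, map_mul,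
        aeval_C, aeval_X, ← Algebra.smul_def, mul_assoc, smul_mul_assoc]
    have := h1 _ ih
    rwa [mul_assoc, ← pow_succ] at this

variable (q : ℝ)

/-- The powers of `B` for `n ≥ 0` and of `B*` for `n < 0`. -/
def podPow : ℤ → Podles q
  | Int.ofNat k => gen (PodRel q) .B ^ k
  | Int.negSucc k => gen (PodRel q) .Bs ^ (k + 1)

variable [NeZero q]

lemma pod_Bs_A : gen (PodRel q) .Bs * gen (PodRel q) .A =
    ((q : ℂ)⁻¹ ^ 2) • (gen (PodRel q) .A * gen (PodRel q) .Bs) := by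
  have hq := q_ne q
  rw [pod_ABs, smul_smul, ← mul_pow, inv_mul_cancel₀ hq, one_pow, one_smul]

lemma exists_podPow_mul_aeval (n : ℤ) (p : ℂ[X]) : ∃ r : ℂ[X],
    podPow q n * aeval (gen (PodRel q) .A) p = aeval (gen (PodRel q) .A) r * podPow q n := by
  cases n with
  | ofNat k => exact ⟨_, mul_aeval_of_skew (pow_mul_of_skew (pod_BA q) k) p⟩
  | negSucc k => exact ⟨_, mul_aeval_of_skew (pow_mul_of_skew (pod_Bs_A q) (k + 1)) p⟩

/-- A factor `B` or `B*` either lengthens the power or meets the opposite letter. Then `B*B` or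
`BB*` is a polynomial in `A`, which moves left through the remaining power by rescaling its
variable. -/
lemma exists_podPow_mul_gen (n : ℤ) (g : PodGen) : ∃ (m : ℤ) (r : ℂ[X]),
    podPow q n * gen (PodRel q) g = aeval (gen (PodRel q) .A) r * podPow q m := by
  cases g with
  | A =>
    obtain ⟨r, hr⟩ := exists_podPow_mul_aeval q n X
    exact ⟨n, r, by rwa [aeval_X] at hr⟩
  | B =>
    cases n with
    | ofNat k => exact ⟨Int.ofNat (k + 1), 1, by rw [map_one, one_mul]; exact (pow_succ _ _).symm⟩
    | negSucc k =>
      obtain ⟨r, hr⟩ := exists_podPow_mul_aeval q (-(k : ℤ)) (X - X ^ 2)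
      -- For `k = 0` the exponent `-k` counts as a power of `B`, and only for `k > 0` as one of
      -- `B*`.
      have hk : podPow q (Int.negSucc k) = podPow q (-(k : ℤ)) * gen (PodRel q) .Bs := by
        cases k with
        | zero =>
          change gen (PodRel q) .Bs ^ (0 + 1) = gen (PodRel q) .B ^ 0 * gen (PodRel q) .Bs
          rw [pow_zero, zero_add, pow_one, one_mul]
        | succ k => exact pow_succ _ _
      refine ⟨-(k : ℤ), r, ?_⟩
      rw [← hr, hk, mul_assoc, pod_BsB]
      simp
  | Bs =>
    cases n with
    | ofNat k =>
      cases k with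
      | zero =>
        refine ⟨-1, 1, ?_⟩
        change gen (PodRel q) .B ^ 0 * gen (PodRel q) .Bs = _ * gen (PodRel q) .Bs ^ (0 + 1)
        rw [map_one, pow_zero, zero_add, pow_one]
      | succ k =>
        obtain ⟨r, hr⟩ := exists_podPow_mul_aeval q (Int.ofNat k)
          ((q : ℂ) ^ 2 • X - (q : ℂ) ^ 4 • X ^ 2)
        have hk : podPow q (Int.ofNat (k + 1)) =
            podPow q (Int.ofNat k) * gen (PodRel q) .B := pow_succ _ _
        refine ⟨Int.ofNat k, r, ?_⟩
        rw [← hr, hk, mul_assoc, pod_BBs]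
        simp only [map_sub, map_smul, map_pow, aeval_X]
    | negSucc k =>
      exact ⟨Int.negSucc (k + 1), 1, by rw [map_one, one_mul]; exact (pow_succ _ _).symm⟩

/-- The linear map with `(pₙ) ↦ ∑ₙ pₙ(A) Bⁿ`, where `B⁻ⁿ` stands for `(B*)ⁿ`. -/
def podOfPoly : (ℤ →₀ ℂ[X]) →ₗ[ℂ] Podles q :=
  Finsupp.lsum ℂ fun n =>
    (LinearMap.mulRight ℂ (podPow q n)) ∘ₗ (aeval (gen (PodRel q) .A)).toLinearMap

@[simp] lemma podOfPoly_single (n : ℤ) (p : ℂ[X]) : podOfPoly q (Finsupp.single n p) =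
    aeval (gen (PodRel q) .A) p * podPow q n := by
  simp [podOfPoly]

lemma podOfPoly_surjective : Function.Surjective (podOfPoly q) := by
  refine mem_of_mul_gen_mem (LinearMap.range (podOfPoly q)) ⟨Finsupp.single 0 1, ?_⟩ ?_
  · rw [podOfPoly_single, map_one, one_mul]
    exact pow_zero _
  · rintro _ ⟨f, rfl⟩ g
    induction f using Finsupp.induction_linear with
    | zero => simp
    | add f₁ f₂ h₁ h₂ =>
      rw [map_add, add_mul]
      exact add_mem h₁ h₂
    | single n p =>
      obtain ⟨m, r, h⟩ := exists_podPow_mul_gen q n g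
      refine ⟨Finsupp.single m (p * r), ?_⟩
      rw [podOfPoly_single, podOfPoly_single, mul_assoc, h, map_mul, mul_assoc]

end Spanning

/-! ## A representation of `S_q^3` on sequences of polynomials -/

section Representation

open Polynomial

/-- The componentwise multiplication with a sequence of polynomials. -/
def diagOp (d : ℤ → ℂ[X]) : Module.End ℂ (ℤ → ℂ[X]) := LinearMap.mulLeft ℂ d

/-- The shift of sequences of polynomials. -/
def shiftOp (k : ℤ) : Module.End ℂ (ℤ → ℂ[X]) := LinearMap.funLeft ℂ ℂ[X] (· + k)

@[simp] lemma diagOp_apply (d f : ℤ → ℂ[X]) (n : ℤ) : diagOp d f n = d n * f n := rfl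

@[simp] lemma shiftOp_apply (k : ℤ) (f : ℤ → ℂ[X]) (n : ℤ) : shiftOp k f n = f (n + k) := rfl

variable (q : ℝ)

/-- The constant polynomial `q⁻ⁿ`. -/
def qWeight (n : ℤ) : ℂ[X] := C ((q : ℂ)⁻¹ ^ n)

variable [NeZero q]

lemma qWeight_add_one (n : ℤ) : qWeight q (n + 1) = C (q : ℂ)⁻¹ * qWeight q n := by
  have hq := inv_ne_zero (q_ne q)
  rw [qWeight, qWeight, ← C_mul, zpow_add_one₀ hq, mul_comm]

lemma qWeight_add_neg_one (n : ℤ) : qWeight q (n + -1) = C (q : ℂ) * qWeight q n := by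
  have hq := inv_ne_zero (q_ne q)
  rw [qWeight, qWeight, ← C_mul, ← sub_eq_add_neg, zpow_sub_one₀ hq, mul_comm, inv_inv]

lemma qWeight_ne_zero (n : ℤ) : qWeight q n ≠ 0 :=
  C_ne_zero.2 (zpow_ne_zero _ (inv_ne_zero (q_ne q)))

/-- The operators of the generators in the representation of `S_q^3`. -/
def sphereRepGen : Fin 2 ⊕ Fin 2 → Module.End ℂ (ℤ → ℂ[X]) :=
  Sum.elim ![diagOp (qWeight q),
      -- With `x₁` a pure shift, this coefficient of the opposite shift is dictated by `v¹x₁ = 1 -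
      -- q⁻²v⁰x₀`.
      diagOp (fun n => 1 - C (q : ℂ)⁻¹ ^ 2 * qWeight q n ^ 2 * X) * shiftOp 1]
    ![diagOp (fun n => qWeight q n * X), shiftOp (-1)]

/-- The representation of `S_q^3` on sequences of polynomials. -/
def sphereRep : Sphere q 2 →ₐ[ℂ] Module.End ℂ (ℤ → ℂ[X]) :=
  presLift (sphereRepGen q) (by
    have hc : C (q : ℂ) * C (q : ℂ)⁻¹ = 1 := by
      rw [← C_mul, mul_inv_cancel₀ (q_ne q), C_1]
    refine sphereRel_of q _ ?_ ?_ ?_ ?_ ?_ ?_ ?_ <;>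
      refine LinearMap.ext fun f => funext fun n => ?_ <;>
      simp [sphereRepGen, qWeight_add_one, qWeight_add_neg_one, smul_eq_C_mul,
        -Complex.coe_smul, -map_inv₀, -inv_pow] <;>
      -- With all weights expressed through the one at `n`, each relation is an identity in the
      -- commutative ring `ℂ[X]` modulo `cd = 1`.
      generalize C (q : ℂ) = c, C (q : ℂ)⁻¹ = d, qWeight q n = a at *
    · ring
    · linear_combination -(a * X * f (n + -1)) * hc
    · ring
    · linear_combination -(a * X * (1 - d ^ 2 * a ^ 2 * X) * f (n + 1)) * hc
    · ring
    · ring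
    · linear_combination -(a ^ 2 * X * f n) * (c * d + 1) * hc)

lemma sphereRep_gen (g : Fin 2 ⊕ Fin 2) :
    sphereRep q (gen (SphereRel q 2) g) = sphereRepGen q g :=
  presLift_gen _ _ _

lemma sphereRep_A : sphereRep q (podToSphere q (gen (PodRel q) .A)) =
    diagOp (fun n => C ((q : ℂ)⁻¹ ^ 2 * ((q : ℂ)⁻¹ ^ n) ^ 2) * X) := by
  rw [podToSphere_gen]
  simp only [podToSphereGen, map_smul, map_mul, sv, sx, sphereRep_gen]
  refine LinearMap.ext fun f => funext fun n => ?_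
  simp only [sphereRepGen, qWeight, LinearMap.smul_apply, Module.End.mul_apply, Pi.smul_apply,
    Sum.elim_inl, Sum.elim_inr, Matrix.cons_val_zero, diagOp_apply, smul_eq_C_mul, C_pow]
  ring

lemma sphereRep_B : sphereRep q (podToSphere q (gen (PodRel q) .B)) =
    diagOp (qWeight q) * shiftOp (-1) := by
  rw [podToSphere_gen]
  simp only [podToSphereGen, map_mul, sv, sx, sphereRep_gen]
  rfl

lemma sphereRep_Bs : sphereRep q (podToSphere q (gen (PodRel q) .Bs)) =
    diagOp (fun n => 1 - C (q : ℂ)⁻¹ ^ 2 * qWeight q n ^ 2 * X) * shiftOp 1 *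
      diagOp (fun n => qWeight q n * X) := by
  rw [podToSphere_gen]
  simp only [podToSphereGen, map_mul, sv, sx, sphereRep_gen]
  rfl

/-! ### Action on sequences supported at one index, and injectivity -/

lemma aeval_diagOp (d : ℤ → ℂ[X]) (p : ℂ[X]) :
    aeval (diagOp d) p = diagOp (fun n => p.comp (d n)) := by
  refine LinearMap.ext fun f => funext fun n => ?_
  induction p using Polynomial.induction_on generalizing f with
  | C b => simp [Algebra.algebraMap_eq_smul_one, smul_eq_C_mul]
  | add p r hp hr => simp_all [add_mul]
  | monomial k b ih =>
    rw [pow_succ, ← mul_assoc, map_mul, aeval_X, Module.End.mul_apply, ih]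
    simp [mul_assoc]

lemma diagOp_single (d : ℤ → ℂ[X]) (n : ℤ) (w : ℂ[X]) :
    diagOp d (Pi.single n w) = Pi.single n (d n * w) := by
  refine funext fun m => ?_
  rw [diagOp_apply]
  by_cases h : m = n
  · subst h
    simp
  · simp [h]

lemma shiftOp_single (k n : ℤ) (w : ℂ[X]) :
    shiftOp k (Pi.single n w) = Pi.single (n - k) w := by
  refine funext fun m => ?_
  rw [shiftOp_apply]
  by_cases h : m = n - k
  · subst h
    simp
  · rw [Pi.single_eq_of_ne h, Pi.single_eq_of_ne (fun h' => h (by omega))]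

/-- Each `B` raises the index by one and each `B*` lowers it, multiplying by a nonzero polynomial;
no product vanishes because `ℂ[X]` is a domain. -/
lemma exists_sphereRep_podPow (n : ℤ) : ∃ w : ℂ[X], w ≠ 0 ∧
    sphereRep q (podToSphere q (podPow q n)) (Pi.single 0 1) = Pi.single n w := by
  have hB (m : ℤ) (w : ℂ[X]) (hw : w ≠ 0) : ∃ w' : ℂ[X], w' ≠ 0 ∧
      sphereRep q (podToSphere q (gen (PodRel q) .B)) (Pi.single m w) = Pi.single (m + 1) w' := by
    refine ⟨_, mul_ne_zero (qWeight_ne_zero q (m + 1)) hw, ?_⟩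
    rw [sphereRep_B, Module.End.mul_apply, shiftOp_single, diagOp_single, sub_neg_eq_add]
  have hBs (m : ℤ) (w : ℂ[X]) (hw : w ≠ 0) : ∃ w' : ℂ[X], w' ≠ 0 ∧
      sphereRep q (podToSphere q (gen (PodRel q) .Bs)) (Pi.single m w) = Pi.single (m - 1) w' := by
    -- The constant term is `1`. With a number in place of `X` this factor could vanish.
    have h1 : (1 - C (q : ℂ)⁻¹ ^ 2 * qWeight q (m - 1) ^ 2 * X : ℂ[X]) ≠ 0 := by
      intro h
      simpa using congrArg (eval 0) h
    refine ⟨_, mul_ne_zero h1 (mul_ne_zero (mul_ne_zero (qWeight_ne_zero q m) X_ne_zero) hw), ?_⟩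
    rw [sphereRep_Bs, Module.End.mul_apply, Module.End.mul_apply, diagOp_single, shiftOp_single,
      diagOp_single]
  have hs (a b : Podles q) (f : ℤ → ℂ[X]) : sphereRep q (podToSphere q (a * b)) f =
      sphereRep q (podToSphere q a) (sphereRep q (podToSphere q b) f) := by
    rw [map_mul, map_mul, Module.End.mul_apply]
  cases n with
  | ofNat k =>
    simp only [podPow]
    induction k with
    | zero => exact ⟨1, one_ne_zero, by simp⟩
    | succ k ih =>
      obtain ⟨w, hw, h⟩ := ih
      obtain ⟨w', hw', h'⟩ := hB _ w hw
      exact ⟨w', hw', by rw [pow_succ', hs, h, h']; rfl⟩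
  | negSucc k =>
    simp only [podPow]
    induction k with
    | zero =>
      obtain ⟨w', hw', h'⟩ := hBs 0 1 one_ne_zero
      exact ⟨w', hw', by rw [zero_add, pow_one, h']; rfl⟩
    | succ k ih =>
      obtain ⟨w, hw, h⟩ := ih
      obtain ⟨w', hw', h'⟩ := hBs _ w hw
      exact ⟨w', hw', by rw [pow_succ', hs, h, h']; rfl⟩

/-- Applied to the sequence supported at 0, the image of `∑ pₙ(A)Bⁿ` has entry `pₙ(q⁻²⁻²ⁿX) wₙ` at
`n`, with `wₙ ≠ 0`. If all entries vanish then so does every `pₙ`, since substituting a nonzero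
multiple of `X` is injective. -/
lemma podToSphere_injective : Function.Injective (podToSphere q) := by
  have hq := inv_ne_zero (q_ne q)
  choose w hw0 hw using exists_sphereRep_podPow q
  have key (f : ℤ →₀ ℂ[X]) (m : ℤ) :
      sphereRep q (podToSphere q (podOfPoly q f)) (Pi.single 0 1) m =
        (f m).comp (C ((q : ℂ)⁻¹ ^ 2 * ((q : ℂ)⁻¹ ^ m) ^ 2) * X) * w m := by
    induction f using Finsupp.induction_linear with
    | zero => simp
    | add f₁ f₂ h₁ h₂ => simp [add_mul, h₁, h₂]
    | single n p =>
      rw [podOfPoly_single, map_mul, map_mul, Module.End.mul_apply, hw, ← aeval_algHom_apply,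
        ← aeval_algHom_apply, sphereRep_A, aeval_diagOp, diagOp_apply]
      by_cases h : n = m
      · subst h
        simp
      · simp [Finsupp.single_eq_of_ne' h, Pi.single_eq_of_ne' h]
  rw [injective_iff_map_eq_zero]
  intro a ha
  obtain ⟨f, rfl⟩ := podOfPoly_surjective q a
  suffices hf : f = 0 by rw [hf, map_zero]
  refine Finsupp.ext fun m => ?_
  have h := key f m
  rw [ha, map_zero, LinearMap.zero_apply, Pi.zero_apply] at h
  have h2 := (mul_eq_zero.1 h.symm).resolve_right (hw0 m)
  rwa [comp_C_mul_X_eq_zero_iff] at h2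
  exact mem_nonZeroDivisors_of_ne_zero
    (mul_ne_zero (pow_ne_zero _ hq) (pow_ne_zero _ (zpow_ne_zero _ hq)))

/-- The isomorphism of *-algebras between the sphere of Podleś and `ℂP_q^1`. -/
theorem podles_equiv_projSpace : Nonempty (Podles q ≃⋆ₐ[ℂ] ProjSpace q 2) := by
  let f : Podles q →⋆ₐ[ℂ] Sphere q 2 := { podToSphere q with map_star' := podToSphere_star q }
  refine ⟨StarAlgEquiv.ofBijective
    (StarAlgHom.codRestrict f (ProjSpace q 2) (podToSphere_mem_projSpace q)) ⟨?_, ?_⟩⟩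
  · intro a b h
    exact podToSphere_injective q (congrArg Subtype.val h)
  · rintro ⟨u, hu⟩
    obtain ⟨a, ha⟩ := mem_range_podToSphere q hu
    exact ⟨a, Subtype.ext ha⟩

end Representation

end QProj

theorem corollary3p5 (q : ℝ) [NeZero q] :
    Nonempty (QProj.ProjSpace q 2 ≃⋆ₐ[ℂ] QProj.Podles q) ∧
      Nonempty (QProj.ProjSpace q 2 ≃⋆ₐ[ℂ] QProj.SUInvariants q) :=
  ⟨(QProj.podles_equiv_projSpace q).map StarAlgEquiv.symm,
    QProj.projSpace_equiv_suInvariants q⟩
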